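/- Let $k$ be a number field, $\overline{\mathbb Q}$ an algebraic closure of $k$, and $G_k=\mathrm{Gal}(\overline{\mathbb Q}/k)$. We work in the category of abelian varieties up to isogeny: $\operatorname{Hom}(A,B)$ and $\operatorname{End}(A)$ denote homomorphisms and endomorphisms tensored with $\mathbb Q$, isogenies are the isomorphisms of this category, and $A\sim B$ means that $A$ and $B$ are isogenous. For $\sigma\in G_k$ and $B/\overline{\mathbb Q}$, ${}^\sigma B$ denotes the base change of $B$ along $\sigma$. An abelian variety $B/\overline{\mathbb Q}$ is an *abelian $k$-variety* if for every $\sigma\in G_k$ there is an isogeny $\mu_\sigma\colon {}^\sigma B\to B$ that is compatible with $\operatorname{End}(B)$, i.e. $\varphi\circ\mu_\sigma=\mu_\sigma\circ{}^\sigma\varphi$ for all $\varphi\in\operatorname{End}(B)$; an elliptic curve that is an abelian $k$-variety is called a *$k$-curve*. Let $R$ be the center of $\operatorname{End}(B)$. For a locally constant system $\{\mu_\sigma\}_{\sigma\in G_k}$ of compatible isogenies (locally constant with respect to a model of $B$ over a finite extension of $k$ over which the isogenies are defined), put $c_B(\sigma,\tau)=\mu_\sigma\circ{}^\sigma\mu_\tau\circ\mu_{\sigma\tau}^{-1}$.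 This is a continuous $2$-cocycle with values in $R^*$ (discrete, with trivial $G_k$-action), and $\gamma_B\in H^2(G_k,R^*)$ denotes its class in continuous cohomology. (1) Let $B/\overline{\mathbb Q}$ be a simple abelian $k$-variety whose endomorphism algebra $\operatorname{End}(B)$ has Schur index $t$, and let $n$ be such that there exists an abelian variety $A/k$ with $A_{\overline{\mathbb Q}}\sim B^n$. Then $\gamma_B^{nt}=1$ in $H^2(G_k,R^*)$, for the class $\gamma_B$ defined by any locally constant system of compatible isogenies. (2) Let $C/\overline{\mathbb Q}$ be a $k$-curve and let $g$ be such that there exists an abelian variety $A/k$ with $A_{\overline{\mathbb Q}}\sim C^g$. Then $\gamma_C^{g}=1$ in $H^2(G_k,R^*)$, where $R$ is the center of $\operatorname{End}(C)$. -/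

import Mathlib

open CategoryTheory Limits MonoidalCategory CartesianMonoidalCategory AlgebraicGeometry
open scoped TensorProduct

universe v u

noncomputable section

namespace RibetClass

section CommGrp

open scoped MonObj

variable {C : Type u} [Category.{v} C] [CartesianMonoidalCategory C] [BraidedCategory C]

/-- Homomorphisms of commutative group objects, written additively. -/
def homAddEquiv (A B : CommGrp C) : (A ⟶ B) ≃ Additive (A.toGrp ⟶ B.toGrp) :=
  InducedCategory.homEquiv.trans Additive.ofMul

/-- `Hom(A, B)` is an abelian group under pointwise addition (`f + g = μ_B ∘ (f, g)`). -/
instance homAddCommGroup (A B : CommGrp C) : AddCommGroup (A ⟶ B) :=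
  (homAddEquiv A B).addCommGroup

lemma hom_add {A B : CommGrp C} (f g : A ⟶ B) :
    (f + g).hom.hom.hom = f.hom.hom.hom * g.hom.hom.hom := rfl

instance commGrpPreadditive : Preadditive (CommGrp C) where
  add_comp A B D f g h := by
    apply CommGrp.hom_ext
    exact MonObj.mul_comp _ _ _
  comp_add A B D f g h := by
    apply CommGrp.hom_ext
    exact MonObj.comp_mul _ _ _

/-- The product of two commutative group objects. -/
def commGrpProd (A B : CommGrp C) : CommGrp C := ⟨A.X ⊗ B.X⟩

/-- The `n`-th power `Aⁿ = A × ⋯ × A` of a commutative group object. -/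
def power (A : CommGrp C) : ℕ → CommGrp C
  | 0 => CommGrp.trivial C
  | n + 1 => commGrpProd (power A n) A

instance mapCommGrp_additive {D : Type*} [Category D] [CartesianMonoidalCategory D]
    [BraidedCategory D] (F : C ⥤ D) [F.Braided] : F.mapCommGrp.Additive where
  map_add {A B f g} := by
    apply CommGrp.hom_ext
    exact Functor.map_mul F _ _
end CommGrp


section Isog

/-- The category `C ⊗ ℚ` of a preadditive category `C`: the objects are those of `C`, and
`Hom(X, Y)` is `ℚ ⊗_ℤ Hom_C(X, Y)`. For abelian varieties this is the category of abelian
varieties up to isogeny; its isomorphisms are the isogenies (up to nonzero rational factors), and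
`End` in it is the endomorphism algebra `End⁰`. -/
structure Isog (C : Type u) where
  /-- The underlying object. -/
  obj : C

namespace Isog

variable {C : Type u} [Category.{v} C] [Preadditive C]

/-- Composition as a bilinear map. -/
def compBilin (X Y Z : C) : (X ⟶ Y) →ₗ[ℤ] (Y ⟶ Z) →ₗ[ℤ] (X ⟶ Z) :=
  LinearMap.mk₂ ℤ (fun f g => f ≫ g) (by simp) (by simp) (by simp) (by simp)

/-- The `ℚ`-bilinear extension of composition. -/
def comp₂ (X Y Z : C) :
    (ℚ ⊗[ℤ] (X ⟶ Y)) →ₗ[ℤ] (ℚ ⊗[ℤ] (Y ⟶ Z)) →ₗ[ℤ] (ℚ ⊗[ℤ] (X ⟶ Z)) :=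
  TensorProduct.map₂ (LinearMap.mul ℤ ℚ) (compBilin X Y Z)

@[simp]
lemma comp₂_tmul {X Y Z : C} (a b : ℚ) (f : X ⟶ Y) (g : Y ⟶ Z) :
    comp₂ X Y Z (a ⊗ₜ f) (b ⊗ₜ g) = (a * b) ⊗ₜ (f ≫ g) := rfl

lemma comp₂_assoc {W X Y Z : C} (f : ℚ ⊗[ℤ] (W ⟶ X)) (g : ℚ ⊗[ℤ] (X ⟶ Y))
    (h : ℚ ⊗[ℤ] (Y ⟶ Z)) :
    comp₂ W Y Z (comp₂ W X Y f g) h = comp₂ W X Z f (comp₂ X Y Z g h) := by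
  induction f with
  | zero => simp
  | add f f' hf hf' => simp [hf, hf']
  | tmul a f =>
    induction g with
    | zero => simp
    | add g g' hg hg' => simp [hg, hg']
    | tmul b g =>
      induction h with
      | zero => simp
      | add h h' hh hh' => rw [map_add, map_add, map_add, hh, hh']
      | tmul c h => simp [mul_assoc]

instance : Category.{v} (Isog C) where
  Hom X Y := ℚ ⊗[ℤ] (X.obj ⟶ Y.obj)
  id X := 1 ⊗ₜ 𝟙 X.obj
  comp f g := comp₂ _ _ _ f g
  id_comp {X Y} f := by
    induction f with
    | zero => simp
    | add f f' hf hf' => rw [map_add, hf, hf']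
    | tmul a f => simp
  comp_id {X Y} f := by
    induction f with
    | zero => simp
    | add f f' hf hf' => rw [map_add, LinearMap.add_apply, hf, hf']
    | tmul a f => simp
  assoc f g h := comp₂_assoc f g h

instance : Preadditive (Isog C) where
  homGroup X Y := inferInstanceAs (AddCommGroup (ℚ ⊗[ℤ] (X.obj ⟶ Y.obj)))
  add_comp _ _ _ f f' g := congrArg (fun l => l g) ((comp₂ _ _ _).map_add f f')
  comp_add _ _ _ f g g' := (comp₂ _ _ _ f).map_add g g'

variable (C) in
/-- The functor `C ⥤ C ⊗ ℚ`, `f ↦ 1 ⊗ f`. -/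
def ofHom : C ⥤ Isog C where
  obj X := ⟨X⟩
  map {X Y} f := (1 ⊗ₜ f : ℚ ⊗[ℤ] (X ⟶ Y))
  map_comp f g := by
    change _ = comp₂ _ _ _ _ _
    simp

variable {D : Type*} [Category D] [Preadditive D]

/-- The `ℚ`-linear extension of an additive functor on morphisms. -/
def mapLin (F : C ⥤ D) [F.Additive] (X Y : C) :
    (ℚ ⊗[ℤ] (X ⟶ Y)) →ₗ[ℤ] (ℚ ⊗[ℤ] (F.obj X ⟶ F.obj Y)) :=
  TensorProduct.map LinearMap.id F.mapAddHom.toIntLinearMap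

@[simp]
lemma mapLin_tmul (F : C ⥤ D) [F.Additive] {X Y : C} (a : ℚ) (f : X ⟶ Y) :
    mapLin F X Y (a ⊗ₜ f) = a ⊗ₜ F.map f := rfl

lemma mapLin_comp (F : C ⥤ D) [F.Additive] {X Y Z : C} (f : ℚ ⊗[ℤ] (X ⟶ Y))
    (g : ℚ ⊗[ℤ] (Y ⟶ Z)) :
    mapLin F X Z (comp₂ _ _ _ f g) = comp₂ _ _ _ (mapLin F _ _ f) (mapLin F _ _ g) := by
  induction f with
  | zero => simp
  | add f f' hf hf' => simp [hf, hf']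
  | tmul a f =>
    induction g with
    | zero => simp
    | add g g' hg hg' => rw [map_add, map_add, map_add, map_add, hg, hg']
    | tmul b g => simp

/-- The extension of an additive functor to `C ⊗ ℚ`. -/
def map (F : C ⥤ D) [F.Additive] : Isog C ⥤ Isog D where
  obj X := ⟨F.obj X.obj⟩
  map {X Y} f := mapLin F X.obj Y.obj f
  map_id X := by
    change mapLin F _ _ (1 ⊗ₜ _) = 1 ⊗ₜ _
    simp
  map_comp f g := mapLin_comp F f g

lemma map_ofHom (F : C ⥤ D) [F.Additive] {X Y : C} (f : X ⟶ Y) :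
    (map F).map ((ofHom C).map f) = (ofHom D).map (F.map f) := rfl

variable {E : Type*} [Category E] [Preadditive E]

/-- An isomorphism of functors `F ⋙ G ≅ H`, seen in `E ⊗ ℚ`. -/
def mapComp {F : C ⥤ D} {G : D ⥤ E} {H : C ⥤ E} [F.Additive] [G.Additive] [H.Additive]
    (e : F ⋙ G ≅ H) (X : Isog C) : (map G).obj ((map F).obj X) ≅ (map H).obj X :=
  (ofHom E).mapIso (e.app X.obj)

lemma mapComp_naturality {F : C ⥤ D} {G : D ⥤ E} {H : C ⥤ E} [F.Additive] [G.Additive]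
    [H.Additive] (e : F ⋙ G ≅ H) {X Y : Isog C} (f : X ⟶ Y) :
    (map G).map ((map F).map f) ≫ (mapComp e Y).hom = (mapComp e X).hom ≫ (map H).map f := by
  obtain ⟨X⟩ := X
  obtain ⟨Y⟩ := Y
  change ℚ ⊗[ℤ] (X ⟶ Y) at f
  change comp₂ (G.obj (F.obj X)) (G.obj (F.obj Y)) (H.obj Y)
      (mapLin G _ _ (mapLin F _ _ f)) (1 ⊗ₜ e.hom.app Y) =
    comp₂ (G.obj (F.obj X)) (H.obj X) (H.obj Y) (1 ⊗ₜ e.hom.app X) (mapLin H _ _ f)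
  induction f with
  | zero => simp
  | add f f' hf hf' =>
    rw [map_add, map_add, map_add, map_add, map_add, LinearMap.add_apply, hf, hf']
  | tmul a f =>
    have := e.hom.naturality f
    rw [Functor.comp_map] at this
    simp only [mapLin_tmul, comp₂_tmul, mul_one, one_mul]
    exact congrArg _ this

lemma mapComp_assoc {E' : Type*} [Category E'] [Preadditive E']
    {F : C ⥤ D} {G : D ⥤ E} {H : E ⥤ E'} {FG : C ⥤ E} {GH : D ⥤ E'} {FGH : C ⥤ E'}
    [F.Additive] [G.Additive] [H.Additive] [FG.Additive] [GH.Additive] [FGH.Additive]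
    (e₁ : F ⋙ G ≅ FG) (e₂ : G ⋙ H ≅ GH) (e₃ : FG ⋙ H ≅ FGH) (e₄ : F ⋙ GH ≅ FGH) (X : Isog C)
    (h : H.map (e₁.hom.app X.obj) ≫ e₃.hom.app X.obj =
      e₂.hom.app (F.obj X.obj) ≫ e₄.hom.app X.obj) :
    (map H).map (mapComp e₁ X).hom ≫ (mapComp e₃ X).hom =
      (mapComp e₂ ((map F).obj X)).hom ≫ (mapComp e₄ X).hom := by
  have := congrArg (ofHom E').map h
  rw [Functor.map_comp, Functor.map_comp] at this
  exact this

end Isog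

end Isog

section BaseChange

/-- The canonical isomorphism `(X ×_S T) ×_T U ≅ X ×_S U`. -/
def pullbackCompIso {X S T U : Scheme.{u}} (f : X ⟶ S) (a : T ⟶ S) (b : U ⟶ T) (c : U ⟶ S)
    (h : b ≫ a = c) : pullback (pullback.snd f a) b ≅ pullback f c where
  hom := pullback.lift (pullback.fst _ _ ≫ pullback.fst _ _) (pullback.snd _ _)
    (by rw [Category.assoc, pullback.condition, pullback.condition_assoc, h])
  inv := pullback.lift (pullback.lift (pullback.fst _ _) (pullback.snd _ _ ≫ b)
    (by rw [pullback.condition, Category.assoc, h])) (pullback.snd _ _)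
    (by rw [pullback.lift_snd])
  hom_inv_id := by
    apply pullback.hom_ext
    · apply pullback.hom_ext <;>
        simp only [Category.assoc, Category.id_comp, pullback.lift_fst, pullback.lift_snd,
          pullback.lift_snd_assoc, pullback.condition]
    · simp only [Category.assoc, Category.id_comp, pullback.lift_snd]
  inv_hom_id := by
    apply pullback.hom_ext <;>
      simp only [Category.assoc, Category.id_comp, pullback.lift_fst, pullback.lift_snd,
        pullback.lift_fst_assoc]

lemma pullbackCompIso_hom_fst {X S T U : Scheme.{u}} (f : X ⟶ S) (a : T ⟶ S) (b : U ⟶ T)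
    (c : U ⟶ S) (h : b ≫ a = c) :
    (pullbackCompIso f a b c h).hom ≫ pullback.fst f c = pullback.fst _ _ ≫ pullback.fst _ _ :=
  pullback.lift_fst _ _ _

lemma pullbackCompIso_hom_fst_assoc {X S T U Z : Scheme.{u}} (f : X ⟶ S) (a : T ⟶ S) (b : U ⟶ T)
    (c : U ⟶ S) (h : b ≫ a = c) (z : X ⟶ Z) :
    (pullbackCompIso f a b c h).hom ≫ pullback.fst f c ≫ z =
      pullback.fst _ _ ≫ pullback.fst _ _ ≫ z := by
  rw [← Category.assoc, pullbackCompIso_hom_fst, Category.assoc]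

lemma pullbackCompIso_hom_snd {X S T U : Scheme.{u}} (f : X ⟶ S) (a : T ⟶ S) (b : U ⟶ T)
    (c : U ⟶ S) (h : b ≫ a = c) :
    (pullbackCompIso f a b c h).hom ≫ pullback.snd f c = pullback.snd _ _ :=
  pullback.lift_snd _ _ _

lemma pullbackCompIso_assoc {X S T U V : Scheme.{u}} (f : X ⟶ S) (a : T ⟶ S) (b : U ⟶ T)
    (d : V ⟶ U) (ab : U ⟶ S) (bd : V ⟶ T) (c : V ⟶ S) (h₁ : b ≫ a = ab) (h₂ : d ≫ b = bd)
    (h₃ : d ≫ ab = c) (h₄ : bd ≫ a = c)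
    (w : pullback (pullback.snd (pullback.snd f a) b) d ⟶ pullback (pullback.snd f ab) d)
    (hw₁ : w ≫ pullback.fst _ _ = pullback.fst _ _ ≫ (pullbackCompIso f a b ab h₁).hom)
    (hw₂ : w ≫ pullback.snd _ _ = pullback.snd _ _) :
    w ≫ (pullbackCompIso f ab d c h₃).hom =
      (pullbackCompIso (pullback.snd f a) b d bd h₂).hom ≫ (pullbackCompIso f a bd c h₄).hom := by
  apply pullback.hom_ext
  · rw [Category.assoc, Category.assoc, pullbackCompIso_hom_fst, pullbackCompIso_hom_fst,
      pullbackCompIso_hom_fst_assoc, reassoc_of% hw₁, pullbackCompIso_hom_fst]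
  · rw [Category.assoc, Category.assoc, pullbackCompIso_hom_snd, pullbackCompIso_hom_snd,
      pullbackCompIso_hom_snd, hw₂]

lemma overPullback_map_fst {S T : Scheme.{u}} (a : T ⟶ S) {X Y : Over S} (f : X ⟶ Y) :
    ((Over.pullback a).map f).left ≫ pullback.fst Y.hom a = pullback.fst X.hom a ≫ f.left :=
  pullback.lift_fst _ _ _

lemma overPullback_map_snd {S T : Scheme.{u}} (a : T ⟶ S) {X Y : Over S} (f : X ⟶ Y) :
    ((Over.pullback a).map f).left ≫ pullback.snd Y.hom a = pullback.snd X.hom a :=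
  pullback.lift_snd _ _ _

/-- Transitivity of base change. -/
def overPullbackComp {S T U : Scheme.{u}} (a : T ⟶ S) (b : U ⟶ T) (c : U ⟶ S) (h : b ≫ a = c) :
    Over.pullback a ⋙ Over.pullback b ≅ Over.pullback c :=
  NatIso.ofComponents
    (fun X => Over.isoMk (pullbackCompIso X.hom a b c h) (pullbackCompIso_hom_snd _ _ _ _ _))
    (fun {X Y} f => by
      apply Over.OverMorphism.ext
      apply pullback.hom_ext
      · change (((Over.pullback b).map ((Over.pullback a).map f)).left ≫
          (pullbackCompIso Y.hom a b c h).hom) ≫ pullback.fst _ _ =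
          ((pullbackCompIso X.hom a b c h).hom ≫ ((Over.pullback c).map f).left) ≫ pullback.fst _ _
        rw [Category.assoc, Category.assoc, pullbackCompIso_hom_fst, overPullback_map_fst,
          pullbackCompIso_hom_fst_assoc]
        erw [reassoc_of% (overPullback_map_fst b ((Over.pullback a).map f))]
        rw [overPullback_map_fst]
        simp
      · change (((Over.pullback b).map ((Over.pullback a).map f)).left ≫
          (pullbackCompIso Y.hom a b c h).hom) ≫ pullback.snd _ _ =
          ((pullbackCompIso X.hom a b c h).hom ≫ ((Over.pullback c).map f).left) ≫ pullback.snd _ _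
        rw [Category.assoc, Category.assoc, pullbackCompIso_hom_snd, overPullback_map_snd,
          pullbackCompIso_hom_snd]
        exact overPullback_map_snd b ((Over.pullback a).map f))

/-- Commutative group schemes over the field `K`. -/
abbrev GrpSch (K : Type u) [Field K] := CommGrp (Over (Spec (CommRingCat.of K)))

variable {K L M N : Type u} [Field K] [Field L] [Field M] [Field N]

/-- Base change `A ↦ A ×_{Spec K} Spec L` of group schemes along `φ : K → L`. -/
def baseChange (φ : K →+* L) : GrpSch K ⥤ GrpSch L :=
  (Over.pullback (Spec.map (CommRingCat.ofHom φ))).mapCommGrp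

instance (φ : K →+* L) : (baseChange φ).Additive :=
  inferInstanceAs (Functor.mapCommGrp _).Additive

/-- The canonical isomorphism `(A_L)_M ≅ A_M`. -/
def baseChangeComp (φ : K →+* L) (ψ : L →+* M) (χ : K →+* M) (h : ψ.comp φ = χ) :
    baseChange φ ⋙ baseChange ψ ≅ baseChange χ :=
  Functor.mapCommGrpCompIso.symm ≪≫ Functor.mapCommGrpNatIso (overPullbackComp _ _ _
    (by subst h; simp [Spec.map_comp]))

lemma baseChangeComp_left (φ : K →+* L) (ψ : L →+* M) (χ : K →+* M) (h : ψ.comp φ = χ)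
    (A : GrpSch K) (h' : Spec.map (CommRingCat.ofHom ψ) ≫ Spec.map (CommRingCat.ofHom φ) =
      Spec.map (CommRingCat.ofHom χ)) :
    ((baseChangeComp φ ψ χ h).hom.app A).hom.hom.hom.left =
      (pullbackCompIso A.X.hom _ _ _ h').hom := by
  exact Category.id_comp (pullbackCompIso A.X.hom _ _ _ h').hom

lemma baseChange_map_left (φ : K →+* L) {A B : GrpSch K} (f : A ⟶ B) :
    ((baseChange φ).map f).hom.hom.hom.left =
      ((Over.pullback (Spec.map (CommRingCat.ofHom φ))).map f.hom.hom.hom).left := rfl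

lemma baseChangeComp_assoc (φ : K →+* L) (ψ : L →+* M) (ω : M →+* N) (ψφ : K →+* M)
    (ωψ : L →+* N) (χ : K →+* N) (h₁ : ψ.comp φ = ψφ) (h₂ : ω.comp ψ = ωψ) (h₃ : ω.comp ψφ = χ)
    (h₄ : ωψ.comp φ = χ) (A : GrpSch K) :
    (baseChange ω).map ((baseChangeComp φ ψ ψφ h₁).hom.app A) ≫
        (baseChangeComp ψφ ω χ h₃).hom.app A =
      (baseChangeComp ψ ω ωψ h₂).hom.app ((baseChange φ).obj A) ≫
        (baseChangeComp φ ωψ χ h₄).hom.app A := by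
  apply CommGrp.hom_ext
  apply Over.OverMorphism.ext
  have e₁ : Spec.map (CommRingCat.ofHom ψ) ≫ Spec.map (CommRingCat.ofHom φ) =
      Spec.map (CommRingCat.ofHom ψφ) := by subst h₁; simp [Spec.map_comp]
  have e₂ : Spec.map (CommRingCat.ofHom ω) ≫ Spec.map (CommRingCat.ofHom ψ) =
      Spec.map (CommRingCat.ofHom ωψ) := by subst h₂; simp [Spec.map_comp]
  have e₃ : Spec.map (CommRingCat.ofHom ω) ≫ Spec.map (CommRingCat.ofHom ψφ) =
      Spec.map (CommRingCat.ofHom χ) := by subst h₃; simp [Spec.map_comp]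
  have e₄ : Spec.map (CommRingCat.ofHom ωψ) ≫ Spec.map (CommRingCat.ofHom φ) =
      Spec.map (CommRingCat.ofHom χ) := by subst h₄; simp [Spec.map_comp]
  have E₁ := baseChangeComp_left φ ψ ψφ h₁ A e₁
  have E₂ := baseChangeComp_left ψ ω ωψ h₂ ((baseChange φ).obj A) e₂
  have E₃ := baseChangeComp_left ψφ ω χ h₃ A e₃
  have E₄ := baseChangeComp_left φ ωψ χ h₄ A e₄
  change ((baseChange ω).map ((baseChangeComp φ ψ ψφ h₁).hom.app A)).hom.hom.hom.left ≫
      ((baseChangeComp ψφ ω χ h₃).hom.app A).hom.hom.hom.left =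
    ((baseChangeComp ψ ω ωψ h₂).hom.app ((baseChange φ).obj A)).hom.hom.hom.left ≫
        ((baseChangeComp φ ωψ χ h₄).hom.app A).hom.hom.hom.left
  have F₁ := overPullback_map_fst (Spec.map (CommRingCat.ofHom ω))
    ((baseChangeComp φ ψ ψφ h₁).hom.app A).hom.hom.hom
  have F₂ := overPullback_map_snd (Spec.map (CommRingCat.ofHom ω))
    ((baseChangeComp φ ψ ψφ h₁).hom.app A).hom.hom.hom
  rw [baseChange_map_left, E₂, E₃, E₄]
  rw [E₁] at F₁
  exact pullbackCompIso_assoc _ _ _ _ _ _ _ e₁ e₂ e₃ e₄ _ F₁ F₂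

/-- Base change, up to isogeny. -/
def isogBaseChange (φ : K →+* L) : Isog (GrpSch K) ⥤ Isog (GrpSch L) :=
  Isog.map (baseChange φ)

/-- The canonical isomorphism `(A_L)_M ≅ A_M`, up to isogeny. -/
def isogBaseChangeComp (φ : K →+* L) (ψ : L →+* M) (χ : K →+* M) (h : ψ.comp φ = χ)
    (A : Isog (GrpSch K)) :
    (isogBaseChange ψ).obj ((isogBaseChange φ).obj A) ≅ (isogBaseChange χ).obj A :=
  Isog.mapComp (baseChangeComp φ ψ χ h) A

lemma isogBaseChangeComp_naturality (φ : K →+* L) (ψ : L →+* M) (χ : K →+* M)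
    (h : ψ.comp φ = χ) {A B : Isog (GrpSch K)} (f : A ⟶ B) :
    (isogBaseChange ψ).map ((isogBaseChange φ).map f) ≫ (isogBaseChangeComp φ ψ χ h B).hom =
      (isogBaseChangeComp φ ψ χ h A).hom ≫ (isogBaseChange χ).map f := by
  unfold isogBaseChange isogBaseChangeComp
  apply Isog.mapComp_naturality

lemma isogBaseChangeComp_assoc (φ : K →+* L) (ψ : L →+* M) (ω : M →+* N) (ψφ : K →+* M)
    (ωψ : L →+* N) (χ : K →+* N) (h₁ : ψ.comp φ = ψφ) (h₂ : ω.comp ψ = ωψ) (h₃ : ω.comp ψφ = χ)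
    (h₄ : ωψ.comp φ = χ) (A : Isog (GrpSch K)) :
    (isogBaseChange ω).map (isogBaseChangeComp φ ψ ψφ h₁ A).hom ≫
        (isogBaseChangeComp ψφ ω χ h₃ A).hom =
      (isogBaseChangeComp ψ ω ωψ h₂ ((isogBaseChange φ).obj A)).hom ≫
        (isogBaseChangeComp φ ωψ χ h₄ A).hom := by
  unfold isogBaseChange isogBaseChangeComp
  apply Isog.mapComp_assoc
  exact baseChangeComp_assoc φ ψ ω ψφ ωψ χ h₁ h₂ h₃ h₄ A.obj

/-- The endomorphism algebra `End⁰(A) = ℚ ⊗ End(A)`. -/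
abbrev End0 (A : GrpSch K) : Type u := End (⟨A⟩ : Isog (GrpSch K))

end BaseChange

section Cohomology

variable (G M : Type*) [Group G] [TopologicalSpace G] [CommGroup M]

/-- Continuous `2`-cocycles of `G` with values in the discrete module `M` with trivial action.
Continuous means locally constant. -/
def twoCocycles : Subgroup (G × G → M) where
  carrier := {c | IsLocallyConstant c ∧
    ∀ σ τ ρ : G, c (σ, τ) * c (σ * τ, ρ) = c (σ, τ * ρ) * c (τ, ρ)}
  mul_mem' := by
    rintro a b ⟨ha, ha'⟩ ⟨hb, hb'⟩
    refine ⟨ha.mul hb, fun σ τ ρ => ?_⟩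
    simp only [Pi.mul_apply]
    rw [mul_mul_mul_comm, ha', hb', mul_mul_mul_comm]
  one_mem' := ⟨IsLocallyConstant.const 1, fun _ _ _ => rfl⟩
  inv_mem' := by
    rintro a ⟨ha, ha'⟩
    refine ⟨ha.inv, fun σ τ ρ => ?_⟩
    simp only [Pi.inv_apply]
    rw [← mul_inv, ← mul_inv, ha']

/-- Coboundaries of continuous `1`-cochains. -/
def twoCoboundaries : Subgroup (twoCocycles G M) where
  carrier := {c | ∃ b : G → M, IsLocallyConstant b ∧
    ∀ σ τ : G, c.1 (σ, τ) = b σ * b τ * (b (σ * τ))⁻¹}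
  mul_mem' := by
    rintro a b ⟨x, hx, hx'⟩ ⟨y, hy, hy'⟩
    refine ⟨x * y, hx.mul hy, fun σ τ => ?_⟩
    simp only [Subgroup.coe_mul, Pi.mul_apply, hx', hy', mul_inv]
    simp only [mul_assoc, mul_left_comm, mul_comm]
  one_mem' := ⟨1, IsLocallyConstant.const 1, fun _ _ => by simp⟩
  inv_mem' := by
    rintro a ⟨x, hx, hx'⟩
    refine ⟨x⁻¹, hx.inv, fun σ τ => ?_⟩
    simp only [Subgroup.coe_inv, Pi.inv_apply, hx', mul_inv]

/-- The continuous cohomology group `H²(G, M)`, for `M` discrete with trivial action,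
written multiplicatively. -/
def H2 : Type _ := twoCocycles G M ⧸ twoCoboundaries G M

instance : CommGroup (H2 G M) :=
  inferInstanceAs (CommGroup (twoCocycles G M ⧸ twoCoboundaries G M))

end Cohomology

section Galois

variable (k : Type u) {Ω : Type u} [Field k] [Field Ω] [Algebra k Ω]

variable {k} in
/-- The conjugate `B ↦ ^σB`, `φ ↦ ^σφ`: base change along `σ : Ω → Ω`. -/
def conj (σ : Ω ≃ₐ[k] Ω) : Isog (GrpSch Ω) ⥤ Isog (GrpSch Ω) := isogBaseChange (σ : Ω →+* Ω)

variable {k} in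
/-- The canonical identification of `^σ(^τX)` with `^ωX`, where `ω = στ`. -/
def conjComp (σ τ ω : Ω ≃ₐ[k] Ω) (h : σ * τ = ω) (X : Isog (GrpSch Ω)) :
    (conj σ).obj ((conj τ).obj X) ≅ (conj ω).obj X :=
  isogBaseChangeComp (τ : Ω →+* Ω) (σ : Ω →+* Ω) (ω : Ω →+* Ω)
    (RingHom.ext fun x => DFunLike.congr_fun h x) X

variable {k} in
lemma conjComp_naturality (σ τ ω : Ω ≃ₐ[k] Ω) (h : σ * τ = ω) {X Y : Isog (GrpSch Ω)}
    (f : X ⟶ Y) :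
    (conjComp σ τ ω h X).inv ≫ (conj σ).map ((conj τ).map f) =
      (conj ω).map f ≫ (conjComp σ τ ω h Y).inv := by
  rw [Iso.inv_comp_eq, ← Category.assoc, Iso.eq_comp_inv]
  unfold conj conjComp
  apply isogBaseChangeComp_naturality

variable {k} in
lemma conjComp_naturality_assoc (σ τ ω : Ω ≃ₐ[k] Ω) (h : σ * τ = ω) {X Y : Isog (GrpSch Ω)}
    (f : X ⟶ Y) {Z : Isog (GrpSch Ω)} (z : (conj σ).obj ((conj τ).obj Y) ⟶ Z) :
    (conjComp σ τ ω h X).inv ≫ (conj σ).map ((conj τ).map f) ≫ z =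
      (conj ω).map f ≫ (conjComp σ τ ω h Y).inv ≫ z := by
  rw [← Category.assoc, conjComp_naturality, Category.assoc]

variable {k} in
lemma conjComp_assoc (σ τ ρ στ τρ ω : Ω ≃ₐ[k] Ω) (h₁ : σ * τ = στ) (h₂ : τ * ρ = τρ)
    (h₃ : στ * ρ = ω) (h₄ : σ * τρ = ω) (X : Isog (GrpSch Ω)) :
    (conjComp στ ρ ω h₃ X).inv ≫ (conjComp σ τ στ h₁ ((conj ρ).obj X)).inv =
      (conjComp σ τρ ω h₄ X).inv ≫ (conj σ).map (conjComp τ ρ τρ h₂ X).inv := by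
  have h : (conj σ).map (conjComp τ ρ τρ h₂ X).hom ≫ (conjComp σ τρ ω h₄ X).hom =
      (conjComp σ τ στ h₁ ((conj ρ).obj X)).hom ≫ (conjComp στ ρ ω h₃ X).hom := by
    unfold conj conjComp
    apply isogBaseChangeComp_assoc
  rw [← Iso.trans_inv, ← Functor.mapIso_inv, ← Iso.trans_inv]
  congr 1
  exact Iso.ext h.symm

variable {k} in
lemma conjComp_assoc_assoc (σ τ ρ στ τρ ω : Ω ≃ₐ[k] Ω) (h₁ : σ * τ = στ) (h₂ : τ * ρ = τρ)
    (h₃ : στ * ρ = ω) (h₄ : σ * τρ = ω) (X : Isog (GrpSch Ω)) {Z : Isog (GrpSch Ω)}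
    (z : (conj σ).obj ((conj τ).obj ((conj ρ).obj X)) ⟶ Z) :
    (conjComp στ ρ ω h₃ X).inv ≫ (conjComp σ τ στ h₁ ((conj ρ).obj X)).inv ≫ z =
      (conjComp σ τρ ω h₄ X).inv ≫ (conj σ).map (conjComp τ ρ τρ h₂ X).inv ≫ z := by
  rw [← Category.assoc, conjComp_assoc σ τ ρ στ τρ ω h₁ h₂ h₃ h₄, Category.assoc]

variable {k} in
/-- The isogeny `μ : ^σB → B` is compatible with `End(B)`: `φ ∘ μ = μ ∘ ^σφ` for all `φ`. -/
def IsCompatible {B : Isog (GrpSch Ω)} (σ : Ω ≃ₐ[k] Ω) (μ : (conj σ).obj B ≅ B) : Prop :=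
  ∀ φ : B ⟶ B, (conj σ).map φ ≫ μ.hom = μ.hom ≫ φ

/-- An abelian variety over `K`: a proper geometrically integral group scheme over `K`. -/
class IsAbelianVariety {K : Type u} [Field K] (A : GrpSch K) : Prop where
  isProper : IsProper A.X.hom
  geometricallyIntegral : GeometricallyIntegral A.X.hom

/-- A model of `B` over the intermediate field `L`. -/
structure Model (B : GrpSch Ω) (L : IntermediateField k Ω) where
  obj : GrpSch L
  isAbelianVariety : IsAbelianVariety obj
  iso : (baseChange (algebraMap L Ω)).obj obj ≅ B

variable {k} in
/-- The canonical isomorphism `^uB ≅ B` given by a model of `B` over `L`, for `u` fixing `L`. -/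
def Model.descentIso {B : GrpSch Ω} {L : IntermediateField k Ω} (m : Model k B L)
    (u : Ω ≃ₐ[k] Ω) (hu : u ∈ L.fixingSubgroup) :
    (conj u).obj ⟨B⟩ ≅ ⟨B⟩ :=
  (Isog.ofHom (GrpSch Ω)).mapIso ((baseChange (u : Ω →+* Ω)).mapIso m.iso.symm ≪≫
    (baseChangeComp (algebraMap L Ω) (u : Ω →+* Ω) (algebraMap L Ω)
      (RingHom.ext fun x => hu x)).app m.obj ≪≫ m.iso)

/-- A locally constant system of compatible isogenies `μ_σ : ^σB → B`, `σ ∈ Gal(Ω/k)`.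
Local constancy: there are a finite extension `L/k` in `Ω` and a model of `B` over `L` such that,
`f_u : ^uB → B` denoting the isomorphisms given by the model, `μ_{σu} = μ_σ ∘ ^σf_u`
(under the identification of `^{σu}B` with `^σB` the isogeny only depends on the coset of `σ`) and
`μ_{uσ} = f_u ∘ ^uμ_σ` (the isogenies are defined over `L`), for all `σ` and all `u` fixing `L`. -/
structure CompatibleSystem (B : GrpSch Ω) where
  iso (σ : Ω ≃ₐ[k] Ω) : (conj σ).obj ⟨B⟩ ≅ ⟨B⟩
  compatible (σ : Ω ≃ₐ[k] Ω) : IsCompatible σ (iso σ)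
  locallyConstant : ∃ (L : IntermediateField k Ω) (_ : FiniteDimensional k L) (m : Model k B L),
    ∀ (σ u : Ω ≃ₐ[k] Ω) (hu : u ∈ L.fixingSubgroup),
      iso (σ * u) = (conjComp σ u _ rfl ⟨B⟩).symm ≪≫ (conj σ).mapIso (m.descentIso u hu) ≪≫ iso σ ∧
      iso (u * σ) = (conjComp u σ _ rfl ⟨B⟩).symm ≪≫ (conj u).mapIso (iso σ) ≪≫ m.descentIso u hu

namespace CompatibleSystem

variable {k} {B : GrpSch Ω} (μ : CompatibleSystem k B)

/-- `c_B(σ, τ) = μ_σ ∘ ^σμ_τ ∘ μ_{στ}⁻¹`, as an automorphism of `B` up to isogeny. -/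
def cocycleIso (σ τ : Ω ≃ₐ[k] Ω) : (⟨B⟩ : Isog (GrpSch Ω)) ≅ ⟨B⟩ :=
  (μ.iso (σ * τ)).symm ≪≫ (conjComp σ τ _ rfl ⟨B⟩).symm ≪≫ (conj σ).mapIso (μ.iso τ) ≪≫ μ.iso σ

lemma iso_comp_cocycleIso (σ τ ω : Ω ≃ₐ[k] Ω) (h : σ * τ = ω) :
    (μ.iso ω).hom ≫ (μ.cocycleIso σ τ).hom =
      (conjComp σ τ ω h ⟨B⟩).inv ≫ (conj σ).map (μ.iso τ).hom ≫ (μ.iso σ).hom := by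
  subst h
  simp [cocycleIso]

lemma cocycleIso_central (σ τ : Ω ≃ₐ[k] Ω) (φ : (⟨B⟩ : Isog (GrpSch Ω)) ⟶ ⟨B⟩) :
    (μ.cocycleIso σ τ).hom ≫ φ = φ ≫ (μ.cocycleIso σ τ).hom := by
  rw [← cancel_epi (μ.iso (σ * τ)).hom, ← Category.assoc, μ.iso_comp_cocycleIso σ τ _ rfl,
    ← Category.assoc (μ.iso (σ * τ)).hom, ← μ.compatible (σ * τ) φ, Category.assoc,
    Category.assoc, Category.assoc, μ.iso_comp_cocycleIso σ τ _ rfl, ← μ.compatible σ φ,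
    ← conjComp_naturality_assoc, ← Functor.map_comp_assoc, ← μ.compatible τ φ,
    Functor.map_comp_assoc]

lemma cocycleIso_cocycle (σ τ ρ : Ω ≃ₐ[k] Ω) :
    (μ.cocycleIso (σ * τ) ρ).hom ≫ (μ.cocycleIso σ τ).hom =
      (μ.cocycleIso τ ρ).hom ≫ (μ.cocycleIso σ (τ * ρ)).hom := by
  rw [← cocycleIso_central μ σ (τ * ρ), ← cancel_epi (μ.iso (σ * τ * ρ)).hom,
    reassoc_of% (μ.iso_comp_cocycleIso (σ * τ) ρ _ rfl), μ.iso_comp_cocycleIso σ τ _ rfl,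
    reassoc_of% (μ.iso_comp_cocycleIso σ (τ * ρ) _ (mul_assoc σ τ ρ).symm),
    ← μ.compatible σ, ← Functor.map_comp_assoc, μ.iso_comp_cocycleIso τ ρ _ rfl,
    ← conjComp_naturality_assoc, Functor.map_comp, Functor.map_comp,
    conjComp_assoc_assoc σ τ ρ _ _ _ rfl rfl rfl (mul_assoc σ τ ρ).symm]
  simp only [Category.assoc]

lemma exists_cocycleIso_invariant : ∃ (L : IntermediateField k Ω) (_ : FiniteDimensional k L),
    ∀ σ τ u : Ω ≃ₐ[k] Ω, u ∈ L.fixingSubgroup →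
      μ.cocycleIso (u * σ) τ = μ.cocycleIso σ τ ∧ μ.cocycleIso σ (τ * u) = μ.cocycleIso σ τ := by
  obtain ⟨L, hL, m, h⟩ := μ.locallyConstant
  refine ⟨L, hL, fun σ τ u hu => ?_⟩
  have hr (σ ω : Ω ≃ₐ[k] Ω) (e : σ * u = ω) : (μ.iso ω).hom = (conjComp σ u ω e ⟨B⟩).inv ≫
      (conj σ).map (m.descentIso u hu).hom ≫ (μ.iso σ).hom := by
    subst e
    rw [(h σ u hu).1]
    rfl
  have hl (σ ω : Ω ≃ₐ[k] Ω) (e : u * σ = ω) : (μ.iso ω).hom = (conjComp u σ ω e ⟨B⟩).inv ≫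
      (conj u).map (μ.iso σ).hom ≫ (m.descentIso u hu).hom := by
    subst e
    rw [(h σ u hu).2]
    rfl
  have hd (φ : (⟨B⟩ : Isog (GrpSch Ω)) ⟶ ⟨B⟩) :
      (conj u).map φ ≫ (m.descentIso u hu).hom = (m.descentIso u hu).hom ≫ φ := by
    have h₁ := μ.compatible (u * σ) φ
    rw [hl σ _ rfl, ← conjComp_naturality_assoc, Category.assoc, Category.assoc, cancel_epi,
      ← Functor.map_comp_assoc, μ.compatible σ φ, Functor.map_comp, Category.assoc,
      cancel_epi] at h₁
    exact h₁
  constructor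
  · apply Iso.ext
    rw [← cancel_epi (μ.iso (u * σ * τ)).hom, μ.iso_comp_cocycleIso (u * σ) τ _ rfl, hl σ _ rfl,
      ← conjComp_naturality_assoc,
      conjComp_assoc_assoc u σ τ _ _ _ rfl rfl rfl (mul_assoc u σ τ).symm,
      hl (σ * τ) _ (mul_assoc u σ τ).symm, Category.assoc, Category.assoc, ← hd,
      ← Functor.map_comp_assoc, ← Functor.map_comp_assoc, ← Functor.map_comp_assoc,
      μ.iso_comp_cocycleIso σ τ _ rfl, Category.assoc]
  · apply Iso.ext
    rw [← cancel_epi (μ.iso (σ * τ * u)).hom,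
      μ.iso_comp_cocycleIso σ (τ * u) _ (mul_assoc σ τ u).symm, hr τ _ rfl,
      hr (σ * τ) _ rfl, Functor.map_comp_assoc, ← conjComp_assoc_assoc σ τ u _ _ _ rfl rfl rfl,
      Functor.map_comp_assoc, conjComp_naturality_assoc, Category.assoc, Category.assoc,
      μ.iso_comp_cocycleIso σ τ _ rfl]

/-- `c_B(σ, τ)` as an element of `R^*`, where `R` is the center of `End⁰(B)`. -/
def cocycle (σ τ : Ω ≃ₐ[k] Ω) : (Subring.center (End0 B))ˣ where
  val := ⟨(μ.cocycleIso σ τ).hom, Subring.mem_center_iff.2 fun φ => μ.cocycleIso_central σ τ φ⟩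
  inv := ⟨(μ.cocycleIso σ τ).inv, Subring.mem_center_iff.2 fun φ => by
    change (μ.cocycleIso σ τ).inv ≫ φ = φ ≫ (μ.cocycleIso σ τ).inv
    rw [Iso.inv_comp_eq, ← Category.assoc, Iso.eq_comp_inv, cocycleIso_central]⟩
  val_inv := Subtype.ext (μ.cocycleIso σ τ).inv_hom_id
  inv_val := Subtype.ext (μ.cocycleIso σ τ).hom_inv_id

lemma cocycle_mem : (fun p : (Ω ≃ₐ[k] Ω) × (Ω ≃ₐ[k] Ω) => μ.cocycle p.1 p.2) ∈
    twoCocycles (Ω ≃ₐ[k] Ω) (Subring.center (End0 B))ˣ := by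
  refine ⟨?_, fun σ τ ρ => ?_⟩
  · obtain ⟨L, hL, h⟩ := μ.exists_cocycleIso_invariant
    rw [IsLocallyConstant.iff_exists_open]
    rintro ⟨σ, τ⟩
    refine ⟨((fun x => x * σ⁻¹) ⁻¹' (L.fixingSubgroup : Set (Ω ≃ₐ[k] Ω))) ×ˢ
      ((fun x => τ⁻¹ * x) ⁻¹' (L.fixingSubgroup : Set (Ω ≃ₐ[k] Ω))), ?_, ?_, ?_⟩
    · have := L.fixingSubgroup_isOpen
      exact (this.preimage (continuous_mul_const _)).prod
        (this.preimage (continuous_const_mul _))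
    · simp
    · rintro ⟨σ', τ'⟩ ⟨hσ, hτ⟩
      have h₁ := (h σ τ' _ hσ).1
      have h₂ := (h σ τ _ hτ).2
      simp only [inv_mul_cancel_right, mul_inv_cancel_left] at h₁ h₂
      apply Units.ext
      apply Subtype.ext
      change (μ.cocycleIso σ' τ').hom = (μ.cocycleIso σ τ).hom
      rw [h₁, h₂]
  · apply Units.ext
    apply Subtype.ext
    exact μ.cocycleIso_cocycle σ τ ρ

/-- The class `γ_B ∈ H²(Gal(Ω/k), R^*)` of the cocycle `c_B`. -/
def cohomologyClass : H2 (Ω ≃ₐ[k] Ω) (Subring.center (End0 B))ˣ :=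
  QuotientGroup.mk (s := twoCoboundaries _ _) ⟨_, μ.cocycle_mem⟩

end CompatibleSystem

/-- `B` is an abelian `k`-variety: it is isogenous to all its conjugates, compatibly with
`End(B)`. -/
def IsKVariety (B : GrpSch Ω) : Prop :=
  IsAbelianVariety B ∧
    ∀ σ : Ω ≃ₐ[k] Ω, ∃ μ : (conj σ).obj (⟨B⟩ : Isog (GrpSch Ω)) ≅ ⟨B⟩, IsCompatible σ μ

/-- `B` has a model up to isogeny over `k`: some abelian variety `A` over `k` satisfies
`A_Ω ∼ B`. -/
def HasModelUpToIsogeny (B : GrpSch Ω) : Prop :=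
  ∃ A : GrpSch k, IsAbelianVariety A ∧
    Nonempty ((⟨(baseChange (algebraMap k Ω)).obj A⟩ : Isog (GrpSch Ω)) ≅ ⟨B⟩)

end Galois

section Properties

variable {K : Type u} [Field K]

/-- A simple abelian variety: nonzero, and without abelian subvarieties other than `0` and
itself. -/
def IsSimpleAbelianVariety (B : GrpSch K) : Prop :=
  IsAbelianVariety B ∧ ¬ IsZero B ∧
    ∀ (Y : GrpSch K) (i : Y ⟶ B), IsAbelianVariety Y → IsClosedImmersion i.hom.hom.hom.left →
      IsZero Y ∨ IsIso i

/-- An elliptic curve: an abelian variety of dimension one. -/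
def IsEllipticCurve (C : GrpSch K) : Prop :=
  IsAbelianVariety C ∧ SmoothOfRelativeDimension 1 C.X.hom

/-- The simple algebra `A`, finite-dimensional over its center, has Schur index `t`:
`A ≅ M_m(D)` for a division algebra `D` of dimension `t²` over its center. -/
def HasSchurIndex (A : Type u) [Ring A] (t : ℕ) : Prop :=
  ∃ (D : Type u) (_ : DivisionRing D) (m : ℕ), 0 < m ∧
    Nonempty (A ≃+* Matrix (Fin m) (Fin m) D) ∧
    Module.Finite (Subring.center D) D ∧ Module.finrank (Subring.center D) D = t ^ 2

end Properties

end RibetClass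

end

/-! Choose projections and inclusions that make A_Ω a power Bⁿ up to isogeny. The canonical
isomorphisms ^σ(A_Ω) → A_Ω satisfy the descent cocycle condition exactly. Transport them to Bⁿ and
compare them with μ_σ on each copy of B: the result is an invertible n × n matrix M_σ over End⁰(B).
Compatibility of μ_σ with endomorphisms removes the Galois twist from products of entries, so M_{στ}
= c_B(σ,τ) M_σ M_τ with c_B(σ,τ) a central scalar (`CompatibleSystem.descentMatrix_mul`). Any
multiplicative map χ from matrices to the center R with χ(r) = r^d on scalars then gives c_B^d as
the coboundary of χ(M)⁻¹ (`CompatibleSystem.cohomologyClass_pow_eq_one`).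

The cochain must be locally constant. Finitely many homomorphisms between schemes of finite
presentation are defined over a finite extension, so M is unchanged on left cosets of an open
subgroup (`exists_conj_map_comp_descentIso`, `CompatibleSystem.exists_matrix`).

For simple B, a zero product of endomorphisms has a zero factor by looking at images
(`exists_image`). Hence End⁰(B) is a division algebra of dimension t² over R, its n × n matrices are
central simple of dimension (nt)², and the reduced norm is a χ with d = nt (`exists_reducedNorm`).

For an elliptic curve End⁰(C) is commutative and χ is the determinant, with d = g. Commutativity
comes from the action on the one-dimensional tangent space at the identity. A commutator h acts
there as zero and commutes with multiplication by two. Comparing the two on successive powers of the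
maximal ideal shows that h is trivial on the local ring at the identity
(`map_eq_zero_of_commute_two`), hence on the whole curve. -/

section ReducedNorm

/-! ### Central simple algebras and the reduced norm. -/

section TensorSimple

variable {F A K : Type*} [Field F] [Ring A] [Algebra F A] [Field K] [Algebra F K] {ι : Type*}

/-- Basis elements of K commute with A inside A ⊗ K, so coordinates form a map of A-bimodules; this
drives the shortest-element argument below. -/
lemma tensorBasis_repr_mul_right (b : Module.Basis ι F K) (x : A ⊗[F] K) (c : A) (i : ι) :
    (Algebra.TensorProduct.basis A b).repr (x * c ⊗ₜ 1) i =
      (Algebra.TensorProduct.basis A b).repr x i * c := by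
  induction x with
  | zero => simp
  | add x y hx hy => simp [add_mul, hx, hy]
  | tmul a k =>
    simp only [Algebra.TensorProduct.tmul_mul_tmul, mul_one,
      Algebra.TensorProduct.basis_repr_tmul, Finsupp.smul_apply, Finsupp.mapRange_apply,
      smul_eq_mul, mul_assoc]
    rw [Algebra.commutes]

lemma tensorBasis_repr_mul_left (b : Module.Basis ι F K) (x : A ⊗[F] K) (c : A) (i : ι) :
    (Algebra.TensorProduct.basis A b).repr (c ⊗ₜ 1 * x) i =
      c * (Algebra.TensorProduct.basis A b).repr x i := by
  induction x with
  | zero => simp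
  | add x y hx hy => simp [mul_add, hx, hy]
  | tmul a k =>
    simp [Algebra.TensorProduct.basis_repr_tmul, mul_assoc]

/-- The base change of a central simple algebra to a field extension is simple. -/
theorem isSimpleRing_tensorProduct [Algebra.IsCentral F A] [IsSimpleRing A] :
    IsSimpleRing (A ⊗[F] K) := by
  classical
  have : Nontrivial A := inferInstance
  let b := Module.Basis.ofVectorSpace F K
  let B := Algebra.TensorProduct.basis A b
  have : Nontrivial (A ⊗[F] K) :=
    Function.Injective.nontrivial
      (Algebra.TensorProduct.includeLeft_injective (R := F) (S := F) (A := A) (B := K)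
        (algebraMap F K).injective)
  refine ⟨⟨fun I => ?_⟩⟩
  by_cases hI : I = ⊥
  · exact Or.inl hI
  right
  -- Take a nonzero element of I whose coordinate vector has the smallest support.
  have hex : ∃ n : ℕ, ∃ x ∈ I, x ≠ 0 ∧ (B.repr x).support.card = n := by
    by_contra! h
    apply hI
    rw [eq_bot_iff]
    intro x hx
    rw [TwoSidedIdeal.mem_bot]
    by_contra hx0
    exact h _ x hx hx0 rfl
  obtain ⟨x, hxI, hx0, hxn⟩ := Nat.find_spec hex
  have hmin (y : A ⊗[F] K) (hy : y ∈ I) (hlt : (B.repr y).support.card <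
      (B.repr x).support.card) : y = 0 := by
    by_contra hy0
    rw [hxn] at hlt
    exact Nat.find_min hex hlt ⟨y, hy, hy0, rfl⟩
  obtain ⟨i, hi⟩ : ∃ i, B.repr x i ≠ 0 := by
    by_contra! h
    exact hx0 (B.repr.map_eq_zero_iff.1 (Finsupp.ext h))
  -- The i-th coordinates of elements of I supported inside the support of x form a nonzero
  -- two-sided ideal of A. Simplicity of A then normalizes the i-th coordinate to 1.
  let J : TwoSidedIdeal A := TwoSidedIdeal.mk'
    {a | ∃ y ∈ I, (B.repr y).support ⊆ (B.repr x).support ∧ B.repr y i = a}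
    ⟨0, I.zero_mem, by simp, by simp⟩
    (by
      rintro _ _ ⟨y, hy, hys, rfl⟩ ⟨z, hz, hzs, rfl⟩
      refine ⟨y + z, I.add_mem hy hz, ?_, by simp⟩
      rw [map_add]
      exact Finsupp.support_add.trans (Finset.union_subset hys hzs))
    (by
      rintro _ ⟨y, hy, hys, rfl⟩
      exact ⟨-y, I.neg_mem hy, by simpa using hys, by simp⟩)
    (by
      rintro a _ ⟨y, hy, hys, rfl⟩
      refine ⟨a ⊗ₜ 1 * y, I.mul_mem_left _ _ hy, fun j hj => hys ?_,
        tensorBasis_repr_mul_left b y a i⟩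
      rw [Finsupp.mem_support_iff, tensorBasis_repr_mul_left] at hj
      rw [Finsupp.mem_support_iff]
      exact right_ne_zero_of_mul hj)
    (by
      rintro _ a ⟨y, hy, hys, rfl⟩
      refine ⟨y * a ⊗ₜ 1, I.mul_mem_right _ _ hy, fun j hj => hys ?_,
        tensorBasis_repr_mul_right b y a i⟩
      rw [Finsupp.mem_support_iff, tensorBasis_repr_mul_right] at hj
      rw [Finsupp.mem_support_iff]
      exact left_ne_zero_of_mul hj)
  have hJ : J ≠ ⊥ := by
    intro h
    have hm : B.repr x i ∈ J := by
      rw [TwoSidedIdeal.mem_mk']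
      exact ⟨x, hxI, subset_rfl, rfl⟩
    rw [h, TwoSidedIdeal.mem_bot] at hm
    exact hi hm
  obtain ⟨y, hyI, hys, hyi⟩ : ∃ y ∈ I, (B.repr y).support ⊆ (B.repr x).support ∧
      B.repr y i = 1 := by
    have := IsSimpleRing.one_mem_of_ne_bot J hJ
    rwa [TwoSidedIdeal.mem_mk'] at this
  -- The commutator with a loses the i-th coordinate, a · 1 - 1 · a = 0, so minimality forces it to
  -- vanish.
  have hcomm (a : A) : a ⊗ₜ 1 * y - y * a ⊗ₜ 1 = 0 := by
    refine hmin _ (I.sub_mem (I.mul_mem_left _ _ hyI) (I.mul_mem_right _ _ hyI)) ?_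
    apply Finset.card_lt_card
    refine Finset.ssubset_iff_of_subset (fun j hj => hys ?_) |>.2 ⟨i, by simpa using hi, ?_⟩
    · rw [Finsupp.mem_support_iff] at hj ⊢
      contrapose! hj
      rw [map_sub, Finsupp.sub_apply, tensorBasis_repr_mul_left, tensorBasis_repr_mul_right, hj]
      simp
    · rw [Finsupp.notMem_support_iff, map_sub, Finsupp.sub_apply, tensorBasis_repr_mul_left,
        tensorBasis_repr_mul_right, hyi]
      simp
  -- Commuting with A makes every coordinate central, hence in F; therefore y lies in 1 ⊗ K and is a
  -- unit.
  have hcent (j) : ∃ r : F, B.repr y j = algebraMap F A r := by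
    rw [← Algebra.IsCentral.mem_center_iff]
    refine Subalgebra.mem_center_iff.2 fun a => ?_
    have := DFunLike.congr_fun (congrArg B.repr (sub_eq_zero.1 (hcomm a))) j
    rwa [tensorBasis_repr_mul_left, tensorBasis_repr_mul_right] at this
  choose r hr using hcent
  have hy : ∃ k : K, y = 1 ⊗ₜ k := by
    refine ⟨∑ j ∈ (B.repr y).support, r j • b j, ?_⟩
    have h := B.linearCombination_repr y
    rw [Finsupp.linearCombination_apply, Finsupp.sum] at h
    rw [TensorProduct.tmul_sum]
    refine h.symm.trans (Finset.sum_congr rfl fun j _ => ?_)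
    rw [hr, Algebra.TensorProduct.basis_apply, TensorProduct.smul_tmul',
      smul_eq_mul, mul_one, ← TensorProduct.smul_tmul, Algebra.algebraMap_eq_smul_one]
  obtain ⟨k, rfl⟩ := hy
  have hk : k ≠ 0 := by
    rintro rfl
    simp at hyi
  have h1 : (1 : A ⊗[F] K) ∈ I := by
    have := I.mul_mem_left (1 ⊗ₜ k⁻¹) _ hyI
    rwa [Algebra.TensorProduct.tmul_mul_tmul, inv_mul_cancel₀ hk, mul_one] at this
  rw [eq_top_iff]
  intro z _
  simpa using I.mul_mem_left z 1 h1

end TensorSimple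

/-- By Skolem–Noether an automorphism of a matrix algebra is a conjugation, which preserves
determinants. -/
lemma Matrix.det_algEquiv {K n : Type*} [Field K] [Fintype n] [DecidableEq n]
    (f : Matrix n n K ≃ₐ[K] Matrix n n K) (M : Matrix n n K) : (f M).det = M.det := by
  obtain ⟨T, hT⟩ := ((Matrix.toLinAlgEquiv' (R := K) (n := n)).symm.trans
    (f.trans Matrix.toLinAlgEquiv')).eq_linearEquivConjAlgEquiv
  have h : Matrix.toLinAlgEquiv' (f M) =
      T.conjAlgEquiv K (Matrix.toLinAlgEquiv' M) := by
    rw [← hT]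
    simp
  have h' : Matrix.toLin' (f M) = T.toLinearMap ∘ₗ Matrix.toLin' M ∘ₗ T.symm.toLinearMap := h
  rw [← LinearMap.det_toLin', h', LinearMap.det_conj, LinearMap.det_toLin']

/-- The reduced norm of a central simple algebra of dimension `d ^ 2` over a field of
characteristic zero. -/
theorem exists_reducedNorm (F A : Type*) [Field F] [CharZero F] [Ring A] [Algebra F A]
    [Algebra.IsCentral F A] [IsSimpleRing A] [FiniteDimensional F A] (d : ℕ)
    (hd : Module.finrank F A = d ^ 2) :
    ∃ N : A →* F, ∀ r : F, N (algebraMap F A r) = r ^ d := by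
  let K := AlgebraicClosure F
  have h₀ : IsSimpleRing (A ⊗[F] K) := isSimpleRing_tensorProduct
  have hs : IsSimpleRing (K ⊗[F] A) := by
    have : Nontrivial (K ⊗[F] A) :=
      (Algebra.TensorProduct.comm F A K).injective.nontrivial
    exact IsSimpleRing.of_surjective (Algebra.TensorProduct.comm F A K).toRingEquiv.toRingHom h₀
      (Algebra.TensorProduct.comm F A K).surjective
  obtain ⟨m, _, ⟨e⟩⟩ := IsSimpleRing.exists_algEquiv_matrix_of_isAlgClosed K (K ⊗[F] A)
  have hfr : Module.finrank K (K ⊗[F] A) = m ^ 2 := by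
    rw [e.toLinearEquiv.finrank_eq, Module.finrank_matrix]
    simp [sq]
  have hm : m = d := by
    rw [Module.finrank_baseChange, hd] at hfr
    exact (Nat.pow_left_injective (n := 2) two_ne_zero hfr).symm
  subst hm
  let φ : A →ₐ[F] Matrix (Fin m) (Fin m) K :=
    (e.toAlgHom.restrictScalars F).comp Algebra.TensorProduct.includeRight
  have hφ (a : A) : φ a = e (1 ⊗ₜ a) := rfl
  -- Galois descent: the determinant does not depend on the splitting, and applying s to the entries
  -- only changes the splitting. So s fixes it, and in characteristic zero the fixed elements of the
  -- algebraic closure lie in F.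
  have hgal (a : A) : (φ a).det ∈ (⊥ : IntermediateField F K) := by
    rw [InfiniteGalois.mem_bot_iff_fixed]
    intro s
    let ψ : A →ₐ[F] Matrix (Fin m) (Fin m) K := (s.toAlgHom.mapMatrix).comp φ
    let Ψ : K ⊗[F] A →ₐ[K] Matrix (Fin m) (Fin m) K :=
      Algebra.TensorProduct.lift (Algebra.ofId K _) ψ fun x y => Algebra.commute_algebraMap_left _ _
    -- The source is simple, so the second splitting is injective; equality of dimensions makes it
    -- bijective.
    have hinj : Function.Injective Ψ := Ψ.toRingHom.injective
    have hbij : Function.Bijective Ψ := by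
      refine ⟨hinj, ?_⟩
      have := LinearMap.injective_iff_surjective_of_finrank_eq_finrank (f := Ψ.toLinearMap)
        e.toLinearEquiv.finrank_eq
      exact this.1 hinj
    let E := AlgEquiv.ofBijective Ψ hbij
    have h := Matrix.det_algEquiv (e.symm.trans E) (φ a)
    have h2 : (e.symm.trans E) (φ a) = s.toAlgHom.mapMatrix (φ a) := by
      rw [hφ, AlgEquiv.trans_apply, AlgEquiv.symm_apply_apply]
      change Ψ (1 ⊗ₜ a) = _
      exact (Algebra.TensorProduct.lift_tmul _ _ _ 1 a).trans (by rw [map_one, one_mul]; rfl)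
    rw [h2] at h
    exact ((s : K →+* K).map_det _).trans h
  have hgal' (a : A) : ∃ r : F, algebraMap F K r = (φ a).det := IntermediateField.mem_bot.1 (hgal a)
  choose N hN using hgal'
  have hinj := (algebraMap F K).injective
  refine ⟨⟨⟨N, hinj ?_⟩, fun a b => hinj ?_⟩, fun r => hinj ?_⟩
  · rw [hN, map_one, map_one, Matrix.det_one]
  · rw [map_mul, hN, hN, hN, map_mul, Matrix.det_mul]
  · change algebraMap F K (N _) = _
    rw [hN, AlgHom.commutes, IsScalarTower.algebraMap_apply F K (Matrix (Fin m) (Fin m) K), map_pow,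
      Matrix.algebraMap_eq_diagonal, Matrix.det_diagonal]
    simp

end ReducedNorm

noncomputable section

namespace RibetClass

/-! ### Powers as biproducts. -/

section Power

/-- `X` is a biproduct of `n` copies of `A`. -/
def IsPower {C : Type*} [Category C] [Preadditive C] (X A : C) (n : ℕ) : Prop :=
  ∃ (p : Fin n → (X ⟶ A)) (q : Fin n → (A ⟶ X)),
    (∀ i j, q i ≫ p j = if i = j then 𝟙 A else 0) ∧ ∑ i, p i ≫ q i = 𝟙 X

namespace IsPower

variable {C : Type*} [Category C] [Preadditive C] {X Y A : C} {n : ℕ}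

lemma of_id_eq_zero (h : 𝟙 X = 0) : IsPower X A 0 :=
  ⟨Fin.elim0, Fin.elim0, fun i => i.elim0, by simpa using h.symm⟩

lemma succ (h : IsPower X A n) (f : Y ⟶ X) (g : Y ⟶ A) (i : X ⟶ Y) (j : A ⟶ Y)
    (hif : i ≫ f = 𝟙 X) (hig : i ≫ g = 0) (hjf : j ≫ f = 0) (hjg : j ≫ g = 𝟙 A)
    (hY : f ≫ i + g ≫ j = 𝟙 Y) : IsPower Y A (n + 1) := by
  obtain ⟨p, q, h₁, h₂⟩ := h
  refine ⟨Fin.lastCases (motive := fun _ => Y ⟶ A) g fun l => f ≫ p l,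
    Fin.lastCases (motive := fun _ => A ⟶ Y) j fun l => q l ≫ i, ?_, ?_⟩
  · intro a b
    refine Fin.lastCases ?_ (fun a => ?_) a <;> refine Fin.lastCases ?_ (fun b => ?_) b
    · simp [hjg]
    · simp [reassoc_of% hjf, (Fin.castSucc_lt_last b).ne']
    · simp [hig, (Fin.castSucc_lt_last a).ne]
    · simp [reassoc_of% hif, h₁]
  · rw [Fin.sum_univ_castSucc]
    simp only [Fin.lastCases_castSucc, Fin.lastCases_last, Category.assoc]
    rw [← Preadditive.comp_sum, ← hY]
    congr 2
    simp_rw [← Category.assoc (p _)]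
    rw [← Preadditive.sum_comp, h₂, Category.id_comp]

lemma of_iso (h : IsPower X A n) (e : Y ≅ X) : IsPower Y A n := by
  obtain ⟨p, q, h₁, h₂⟩ := h
  refine ⟨fun i => e.hom ≫ p i, fun i => q i ≫ e.inv, by simpa using h₁, ?_⟩
  simp_rw [Category.assoc, ← Category.assoc (p _)]
  rw [← Preadditive.comp_sum, ← Preadditive.sum_comp, h₂]
  simp

lemma map {D : Type*} [Category D] [Preadditive D] (h : IsPower X A n) (F : C ⥤ D) [F.Additive] :
    IsPower (F.obj X) (F.obj A) n := by
  obtain ⟨p, q, h₁, h₂⟩ := h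
  refine ⟨fun i => F.map (p i), fun i => F.map (q i), fun i j => ?_, ?_⟩
  · rw [← F.map_comp, h₁]
    split_ifs <;> simp
  · simp_rw [← F.map_comp]
    rw [← F.map_sum, h₂, F.map_id]

end IsPower

open scoped MonObj

variable {C : Type u} [Category.{v} C] [CartesianMonoidalCategory C] [BraidedCategory C]

/-- The first projection `A × B → A`. -/
def prodFst (A B : CommGrp C) : commGrpProd A B ⟶ A :=
  InducedCategory.homMk (Grp.homMk (A := ⟨A.X ⊗ B.X⟩) (B := ⟨A.X⟩) (fst A.X B.X))

/-- The second projection `A × B → B`. -/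
def prodSnd (A B : CommGrp C) : commGrpProd A B ⟶ B :=
  InducedCategory.homMk (Grp.homMk (A := ⟨A.X ⊗ B.X⟩) (B := ⟨B.X⟩) (snd A.X B.X))

/-- The morphism `D → A × B` with given components. -/
def prodLift {A B D : CommGrp C} (f : D ⟶ A) (g : D ⟶ B) : D ⟶ commGrpProd A B :=
  InducedCategory.homMk (Grp.homMk (A := ⟨D.X⟩) (B := ⟨A.X ⊗ B.X⟩)
    (lift f.hom.hom.hom g.hom.hom.hom))

lemma prodLift_fst {A B D : CommGrp C} (f : D ⟶ A) (g : D ⟶ B) :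
    prodLift f g ≫ prodFst A B = f := by
  apply CommGrp.hom_ext
  exact lift_fst f.hom.hom.hom g.hom.hom.hom

lemma prodLift_snd {A B D : CommGrp C} (f : D ⟶ A) (g : D ⟶ B) :
    prodLift f g ≫ prodSnd A B = g := by
  apply CommGrp.hom_ext
  exact lift_snd f.hom.hom.hom g.hom.hom.hom

lemma prod_hom_ext {A B D : CommGrp C} {f g : D ⟶ commGrpProd A B}
    (h₁ : f ≫ prodFst A B = g ≫ prodFst A B) (h₂ : f ≫ prodSnd A B = g ≫ prodSnd A B) :
    f = g := by
  apply CommGrp.hom_ext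
  exact CartesianMonoidalCategory.hom_ext _ _ (congrArg (fun t => t.hom.hom.hom) h₁)
    (congrArg (fun t => t.hom.hom.hom) h₂)

lemma trivial_id_eq_zero : 𝟙 (CommGrp.trivial C) = 0 := by
  apply CommGrp.hom_ext
  exact toUnit_unique _ _

/-- Describing a power by additive identities between morphisms lets additive functors carry it to
the category up to isogeny. -/
theorem isPower_power (A : CommGrp C) (n : ℕ) : IsPower (power A n) A n := by
  induction n with
  | zero => exact .of_id_eq_zero trivial_id_eq_zero
  | succ n ih =>
    refine ih.succ (Y := commGrpProd (power A n) A) (prodFst _ _) (prodSnd _ _)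
      (prodLift (𝟙 _) 0) (prodLift 0 (𝟙 _)) (prodLift_fst _ _) (prodLift_snd _ _)
      (prodLift_fst _ _) (prodLift_snd _ _) ?_
    apply prod_hom_ext
    · simp [prodLift_fst]
    · simp [prodLift_snd]

end Power

section IsogAdditive

variable {C : Type u} [Category.{v} C] [Preadditive C] {D : Type*} [Category D] [Preadditive D]

instance isogMap_additive (F : C ⥤ D) [F.Additive] : (Isog.map F).Additive where
  map_add {X Y f g} := (Isog.mapLin F X.obj Y.obj).map_add f g

instance ofHom_additive : (Isog.ofHom C).Additive where
  map_add {_ _ f g} := TensorProduct.tmul_add (1 : ℚ) f g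

end IsogAdditive

/-! ### The matrix cochain comparing a descent datum with a compatible system. -/

section MatrixCocycle

variable {k Ω : Type u} [Field k] [Field Ω] [Algebra k Ω]

instance conj_additive (σ : Ω ≃ₐ[k] Ω) : (conj σ).Additive :=
  inferInstanceAs (Isog.map _).Additive

/-- The base change of `A` from `k` to `Ω`, up to isogeny. -/
abbrev geometricFiber (A : GrpSch k) : Isog (GrpSch Ω) :=
  ⟨(baseChange (algebraMap k Ω)).obj A⟩

/-- The canonical isomorphism `^σ(A_Ω) ≅ A_Ω` for `A` defined over `k`. -/
def canonicalDescent (A : GrpSch k) (σ : Ω ≃ₐ[k] Ω) :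
    (conj σ).obj (geometricFiber (Ω := Ω) A) ≅ geometricFiber A :=
  isogBaseChangeComp (algebraMap k Ω) (σ : Ω →+* Ω) (algebraMap k Ω)
    (RingHom.ext fun x => σ.commutes x) ⟨A⟩

/-- An object over k carries an honest descent datum: there is no correcting factor here, so the
only obstruction in the matrix identity comes from B. -/
lemma canonicalDescent_mul (A : GrpSch k) (σ τ ω : Ω ≃ₐ[k] Ω) (h : σ * τ = ω) :
    (conj σ).map (canonicalDescent A τ).hom ≫ (canonicalDescent A σ).hom =
      (conjComp σ τ ω h (geometricFiber A)).hom ≫ (canonicalDescent A ω).hom := by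
  unfold canonicalDescent conj conjComp
  apply isogBaseChangeComp_assoc

namespace CompatibleSystem

variable {B : GrpSch Ω} (μ : CompatibleSystem k B)

lemma comp_iso_inv (σ : Ω ≃ₐ[k] Ω) (φ : (⟨B⟩ : Isog (GrpSch Ω)) ⟶ ⟨B⟩) :
    φ ≫ (μ.iso σ).inv = (μ.iso σ).inv ≫ (conj σ).map φ := by
  rw [Iso.comp_inv_eq, Category.assoc, μ.compatible, Iso.inv_hom_id_assoc]

variable {n : ℕ} {A : GrpSch k} (a : Fin n → (geometricFiber (Ω := Ω) A ⟶ ⟨B⟩))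
  (b : Fin n → (⟨B⟩ ⟶ geometricFiber (Ω := Ω) A))

/-- The matrix over `End⁰(B)` comparing the descent datum of `A` with the system `μ`, where `A_Ω`
is identified with a power of `B` by means of projections `a` and inclusions `b`. -/
def descentMatrix (σ : Ω ≃ₐ[k] Ω) : Matrix (Fin n) (Fin n) (End0 B) :=
  Matrix.of fun i j => (μ.iso σ).inv ≫ (conj σ).map (b j) ≫ (canonicalDescent A σ).hom ≫ a i

lemma descentMatrix_apply (σ : Ω ≃ₐ[k] Ω) (i j : Fin n) : μ.descentMatrix a b σ i j =
    (μ.iso σ).inv ≫ (conj σ).map (b j) ≫ (canonicalDescent A σ).hom ≫ a i := rfl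

variable {a b}

lemma isUnit_descentMatrix (h₁ : ∀ i j, b i ≫ a j = if i = j then 𝟙 _ else 0)
    (h₂ : ∑ i, a i ≫ b i = 𝟙 _) (σ : Ω ≃ₐ[k] Ω) : IsUnit (μ.descentMatrix a b σ) := by
  -- The inverse is the matrix of the inverse isomorphism, read in the same coordinates.
  let W : Matrix (Fin n) (Fin n) (End0 B) :=
    Matrix.of fun i j => b j ≫ (canonicalDescent A σ).inv ≫ (conj σ).map (a i) ≫ (μ.iso σ).hom
  refine isUnit_iff_exists.2 ⟨W, ?_, ?_⟩
  · ext i j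
    rw [Matrix.mul_apply, Matrix.one_apply]
    have h (l : Fin n) : μ.descentMatrix a b σ i l * W l j =
        (b j ≫ (canonicalDescent A σ).inv) ≫ (conj σ).map (a l ≫ b l) ≫
          (canonicalDescent A σ).hom ≫ a i := by
      rw [End.mul_def, descentMatrix_apply]
      simp [W]
    simp_rw [h]
    rw [← Preadditive.comp_sum, ← Preadditive.sum_comp, ← Functor.map_sum, h₂,
      CategoryTheory.Functor.map_id, Category.id_comp, Category.assoc, Iso.inv_hom_id_assoc, h₁]
    simp_rw [eq_comm (a := i)]
    rfl
  · ext i j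
    rw [Matrix.mul_apply, Matrix.one_apply]
    have h (l : Fin n) : W i l * μ.descentMatrix a b σ l j =
        ((μ.iso σ).inv ≫ (conj σ).map (b j) ≫ (canonicalDescent A σ).hom) ≫ (a l ≫ b l) ≫
          (canonicalDescent A σ).inv ≫ (conj σ).map (a i) ≫ (μ.iso σ).hom := by
      rw [End.mul_def, descentMatrix_apply]
      simp [W]
    simp_rw [h]
    rw [← Preadditive.comp_sum, ← Preadditive.sum_comp, h₂, Category.id_comp, Category.assoc,
      Category.assoc, Iso.hom_inv_id_assoc, ← Functor.map_comp_assoc, h₁]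
    by_cases hij : i = j
    · subst hij
      rw [if_pos rfl, if_pos rfl, CategoryTheory.Functor.map_id, Category.id_comp, Iso.inv_hom_id]
      rfl
    · rw [if_neg hij, if_neg (Ne.symm hij), Functor.map_zero, zero_comp, comp_zero]

/-- The descent data of A compose exactly, while the μ_σ compose up to c_B(σ,τ); the quotient of the
two therefore carries c_B as a scalar factor. -/
lemma descentMatrix_mul (h₂ : ∑ i, a i ≫ b i = 𝟙 _) (σ τ : Ω ≃ₐ[k] Ω) :
    μ.descentMatrix a b (σ * τ) =
      Matrix.scalar (Fin n) ((μ.cocycle σ τ : Subring.center (End0 B)) : End0 B) *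
        (μ.descentMatrix a b σ * μ.descentMatrix a b τ) := by
  ext i j
  rw [Matrix.scalar_apply, Matrix.diagonal_mul, Matrix.mul_apply]
  have h (l : Fin n) : μ.descentMatrix a b σ i l * μ.descentMatrix a b τ l j =
      ((μ.iso σ).inv ≫ (conj σ).map ((μ.iso τ).inv ≫ (conj τ).map (b j) ≫
        (canonicalDescent A τ).hom)) ≫ (conj σ).map (a l ≫ b l) ≫
          (canonicalDescent A σ).hom ≫ a i := by
    -- Compatibility moves μ_σ⁻¹ to the front at the price of conjugating the other entry by σ. This
    -- is why the matrix identity has no Galois action in it.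
    rw [End.mul_def, descentMatrix_apply, descentMatrix_apply, ← Category.assoc, comp_iso_inv]
    simp
  simp_rw [h]
  rw [← Preadditive.comp_sum, ← Preadditive.sum_comp, ← Functor.map_sum, h₂,
      CategoryTheory.Functor.map_id, Category.id_comp]
  have hc : ((μ.cocycle σ τ : Subring.center (End0 B)) : End0 B) = (μ.cocycleIso σ τ).hom := rfl
  rw [hc, End.mul_def]
  refine Eq.trans ?_ (μ.cocycleIso_central σ τ _)
  rw [descentMatrix_apply, Iso.inv_comp_eq, reassoc_of% (μ.iso_comp_cocycleIso σ τ _ rfl)]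
  simp only [Functor.map_comp, Category.assoc, Iso.hom_inv_id_assoc]
  rw [← Functor.map_comp_assoc, Iso.hom_inv_id, CategoryTheory.Functor.map_id, Category.id_comp,
    conjComp_naturality_assoc, reassoc_of% (canonicalDescent_mul A σ τ _ rfl),
    Iso.inv_hom_id_assoc]

/-- When the identification of A_Ω with the power of B is equivariant for u, the change of the
descent datum under σ ↦ σu cancels the change of μ_σ. -/
lemma descentMatrix_mul_right (h₁ : ∀ i j, b i ≫ a j = if i = j then 𝟙 _ else 0)
    (h₂ : ∑ i, a i ≫ b i = 𝟙 _) (u : Ω ≃ₐ[k] Ω) (f : (conj u).obj (⟨B⟩ : Isog (GrpSch Ω)) ≅ ⟨B⟩)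
    (hf : ∀ i, (conj u).map (a i) ≫ f.hom = (canonicalDescent A u).hom ≫ a i)
    (σ : Ω ≃ₐ[k] Ω)
    (hσ : μ.iso (σ * u) = (conjComp σ u _ rfl ⟨B⟩).symm ≪≫ (conj σ).mapIso f ≪≫ μ.iso σ) :
    μ.descentMatrix a b (σ * u) = μ.descentMatrix a b σ := by
  -- Equivariance of the projections passes to the inclusions, because together they are mutually
  -- inverse.
  have hb (j : Fin n) : (conj u).map (b j) ≫ (canonicalDescent A u).hom = f.hom ≫ b j := by
    rw [← Category.comp_id (_ ≫ _), ← h₂, Preadditive.comp_sum]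
    have (i : Fin n) : ((conj u).map (b j) ≫ (canonicalDescent A u).hom) ≫ a i ≫ b i =
        if j = i then f.hom ≫ b j else 0 := by
      rw [Category.assoc, ← reassoc_of% (hf i), ← Functor.map_comp_assoc, h₁]
      split_ifs with hij
      · rw [hij, CategoryTheory.Functor.map_id, Category.id_comp]
      · rw [Functor.map_zero, zero_comp]
    simp_rw [this]
    simp
  ext i j
  rw [descentMatrix_apply, descentMatrix_apply, hσ]
  simp only [Iso.trans_inv, Iso.symm_inv, Functor.mapIso_inv, Category.assoc]
  have h := canonicalDescent_mul A σ u _ rfl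
  rw [← Iso.inv_comp_eq] at h
  rw [← h]
  simp only [Category.assoc]
  rw [← conjComp_naturality_assoc, Iso.hom_inv_id_assoc]
  rw [← Functor.map_comp_assoc _ ((conj u).map (b j)), hb, Functor.map_comp_assoc,
    ← Functor.map_comp_assoc (conj σ) f.inv, Iso.inv_hom_id, CategoryTheory.Functor.map_id,
    Category.id_comp]

/-- If `χ` is a multiplicative map from matrices over `End⁰(B)` to the center acting as the
`d`-th power on scalars, then a locally constant comparison with a descent datum shows that the
`d`-th power of the class of `μ` is trivial. -/
theorem cohomologyClass_pow_eq_one {n d : ℕ} (M : (Ω ≃ₐ[k] Ω) → Matrix (Fin n) (Fin n) (End0 B))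
    (hM : IsLocallyConstant M) (hunit : ∀ σ, IsUnit (M σ))
    (hmul : ∀ σ τ, M (σ * τ) =
      Matrix.scalar (Fin n) ((μ.cocycle σ τ : Subring.center (End0 B)) : End0 B) * (M σ * M τ))
    (χ : Matrix (Fin n) (Fin n) (End0 B) →* Subring.center (End0 B))
    (hχ : ∀ r : Subring.center (End0 B), χ (Matrix.scalar (Fin n) (r : End0 B)) = r ^ d) :
    μ.cohomologyClass ^ d = 1 := by
  -- Applying χ to M_{στ} = c M_σ M_τ puts c^d on the side of M_{στ}, hence the inverse: c^d = β_σ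
  -- β_τ β_{στ}⁻¹ for β = χ(M)⁻¹.
  let β : (Ω ≃ₐ[k] Ω) → (Subring.center (End0 B))ˣ := fun σ => (Units.map χ (hunit σ).unit)⁻¹
  have hβ (σ) : (((β σ)⁻¹ : (Subring.center (End0 B))ˣ) : Subring.center (End0 B)) = χ (M σ) := by
    simp [β]
  refine (QuotientGroup.eq_one_iff (N := twoCoboundaries _ _)
    ((⟨_, μ.cocycle_mem⟩ : twoCocycles _ _) ^ d)).2 ⟨β, ?_, fun σ τ => ?_⟩
  · rw [IsLocallyConstant.iff_eventually_eq] at hM ⊢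
    intro σ
    filter_upwards [hM σ] with τ hτ
    apply inv_injective
    apply Units.ext
    rw [hβ, hβ, hτ]
  · change μ.cocycle σ τ ^ d = _
    rw [eq_mul_inv_iff_mul_eq, ← inv_inj, mul_inv, mul_inv, inv_mul_eq_iff_eq_mul]
    apply Units.ext
    rw [Units.val_mul, Units.val_mul, hβ, hβ, hβ, hmul, map_mul, map_mul, hχ,
      Units.val_pow_eq_pow_val]

end CompatibleSystem

end MatrixCocycle

/-! ### Spreading out: homomorphisms over Ω are defined over finite extensions. -/

section Spreading

lemma isAffineHom_pullback_fst {X S T : Scheme.{u}} (f : X ⟶ S) (g : T ⟶ S) [IsAffineHom g] :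
    IsAffineHom (pullback.fst f g) :=
  MorphismProperty.of_isPullback (P := @IsAffineHom) (IsPullback.of_hasPullback f g).flip
    inferInstance

lemma compactSpace_pullback {X S T : Scheme.{u}} (f : X ⟶ S) (g : T ⟶ S) [QuasiCompact f]
    [CompactSpace T] : CompactSpace (pullback f g :) :=
  QuasiCompact.compactSpace_of_compactSpace (pullback.snd f g)

lemma quasiSeparatedSpace_pullback {X S T : Scheme.{u}} (f : X ⟶ S) (g : T ⟶ S)
    [QuasiSeparated f] [QuasiSeparatedSpace T] : QuasiSeparatedSpace (pullback f g :) :=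
  quasiSeparatedSpace_of_quasiSeparated (pullback.snd f g)

variable {k Ω : Type u} [Field k] [Field Ω] [Algebra k Ω]

/-- The finite extensions of `k` in `Ω` that contain `L`. -/
abbrev FiniteOver (L : IntermediateField k Ω) : Type u :=
  {E : IntermediateField k Ω // FiniteDimensional k E ∧ L ≤ E}

namespace FiniteOver

variable (L : IntermediateField k Ω)

instance : IsDirectedOrder (FiniteOver L) where
  directed E E' := by
    have := E.2.1
    have := E'.2.1
    exact ⟨⟨E.1 ⊔ E'.1, inferInstance, E.2.2.trans le_sup_left⟩,
      (le_sup_left : E.1 ≤ E.1 ⊔ E'.1), (le_sup_right : E'.1 ≤ E.1 ⊔ E'.1)⟩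

lemma nonempty [FiniteDimensional k L] : Nonempty (FiniteOver L) := ⟨⟨L, inferInstance, le_rfl⟩⟩

/-- The diagram of the rings `E`. -/
def ringDiagram : FiniteOver L ⥤ CommRingCat.{u} where
  obj E := CommRingCat.of E.1
  map f := CommRingCat.ofHom (IntermediateField.inclusion (leOfHom f)).toRingHom

/-- The field `Ω` as a cocone over its finite subextensions. -/
def ringCocone : Cocone (ringDiagram L) where
  pt := CommRingCat.of Ω
  ι :=
    { app E := CommRingCat.ofHom (algebraMap E.1 Ω)
      naturality _ _ _ := rfl }

/-- An algebraic extension is the colimit of its finite subextensions. -/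
def isColimitRingCocone [Algebra.IsAlgebraic k Ω] [FiniteDimensional k L] :
    IsColimit (ringCocone L) := by
  have := nonempty L
  have : ReflectsColimitsOfShape (FiniteOver L) (forget CommRingCat.{u}) :=
    ⟨fun {_} => reflectsColimit_of_reflectsIsomorphisms _ _⟩
  refine isColimitOfReflects (forget CommRingCat.{u}) ?_
  refine Types.FilteredColimit.isColimitOf' _ _ (fun x => ?_) fun E x y h => ?_
  · change Ω at x
    have hx : FiniteDimensional k (IntermediateField.adjoin k {x}) :=
      IntermediateField.adjoin.finiteDimensional (Algebra.IsIntegral.isIntegral x)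
    refine ⟨⟨L ⊔ IntermediateField.adjoin k {x}, inferInstance, le_sup_left⟩,
      (⟨x, (le_sup_right : IntermediateField.adjoin k {x} ≤ L ⊔ _)
        (IntermediateField.mem_adjoin_simple_self k x)⟩ : (L ⊔ IntermediateField.adjoin k {x} :
          IntermediateField k Ω)), rfl⟩
  · exact ⟨E, 𝟙 E, congrArg _ (Subtype.ext h)⟩

variable {X : Scheme.{u}} (f : X ⟶ Spec (CommRingCat.of k))

lemma spec_condition (E : IntermediateField k Ω) :
    Spec.map (CommRingCat.ofHom (algebraMap E Ω)) ≫ Spec.map (CommRingCat.ofHom (algebraMap k E)) =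
      Spec.map (CommRingCat.ofHom (algebraMap k Ω)) := by
  rw [← Spec.map_comp]
  rfl

/-- The morphism `X_Ω → X_E`. -/
def toBaseChange (E : IntermediateField k Ω) :
    pullback f (Spec.map (CommRingCat.ofHom (algebraMap k Ω))) ⟶
      pullback f (Spec.map (CommRingCat.ofHom (algebraMap k E))) :=
  pullback.lift (pullback.fst _ _)
    (pullback.snd _ _ ≫ Spec.map (CommRingCat.ofHom (algebraMap E Ω)))
    (by rw [Category.assoc, spec_condition, pullback.condition])

lemma toBaseChange_fst (E : IntermediateField k Ω) :
    toBaseChange f E ≫ pullback.fst _ _ = pullback.fst _ _ := pullback.lift_fst _ _ _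

lemma toBaseChange_snd (E : IntermediateField k Ω) : toBaseChange f E ≫ pullback.snd _ _ =
    pullback.snd _ _ ≫ Spec.map (CommRingCat.ofHom (algebraMap E Ω)) := pullback.lift_snd _ _ _

/-- The morphism `Spec E' → Spec E` for `E ⊆ E'`. -/
def specInclusion {E E' : IntermediateField k Ω} (h : E ≤ E') :
    Spec (CommRingCat.of E') ⟶ Spec (CommRingCat.of E) :=
  Spec.map (CommRingCat.ofHom (IntermediateField.inclusion h).toRingHom)

lemma specInclusion_comp_algebraMap {E E' : IntermediateField k Ω} (h : E ≤ E') :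
    specInclusion h ≫ Spec.map (CommRingCat.ofHom (algebraMap k E)) =
      Spec.map (CommRingCat.ofHom (algebraMap k E')) := by
  rw [specInclusion, ← Spec.map_comp]
  rfl

lemma algebraMap_comp_specInclusion {E E' : IntermediateField k Ω} (h : E ≤ E') :
    Spec.map (CommRingCat.ofHom (algebraMap E' Ω)) ≫ specInclusion h =
      Spec.map (CommRingCat.ofHom (algebraMap E Ω)) := by
  rw [specInclusion, ← Spec.map_comp]
  rfl

lemma specInclusion_refl (E : IntermediateField k Ω) : specInclusion (le_refl E) = 𝟙 _ :=
  Spec.map_id _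

lemma specInclusion_trans {E E' E'' : IntermediateField k Ω} (h : E ≤ E') (h' : E' ≤ E'') :
    specInclusion (h.trans h') = specInclusion h' ≫ specInclusion h := by
  rw [specInclusion, specInclusion, specInclusion, ← Spec.map_comp]
  rfl

/-- The morphism `X_{E'} → X_E` for `E ⊆ E'`. -/
def transition {E E' : IntermediateField k Ω} (h : E ≤ E') :
    pullback f (Spec.map (CommRingCat.ofHom (algebraMap k E'))) ⟶
      pullback f (Spec.map (CommRingCat.ofHom (algebraMap k E))) :=
  pullback.lift (pullback.fst _ _) (pullback.snd _ _ ≫ specInclusion h)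
    (by rw [Category.assoc, specInclusion_comp_algebraMap, pullback.condition])

lemma transition_fst {E E' : IntermediateField k Ω} (h : E ≤ E') :
    transition f h ≫ pullback.fst _ _ = pullback.fst _ _ := pullback.lift_fst _ _ _

lemma transition_snd {E E' : IntermediateField k Ω} (h : E ≤ E') :
    transition f h ≫ pullback.snd _ _ = pullback.snd _ _ ≫ specInclusion h :=
  pullback.lift_snd _ _ _

lemma transition_refl (E : IntermediateField k Ω) : transition f (le_refl E) = 𝟙 _ := by
  apply pullback.hom_ext
  · rw [transition_fst, Category.id_comp]
  · rw [transition_snd, specInclusion_refl, Category.id_comp, Category.comp_id]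

lemma transition_trans {E E' E'' : IntermediateField k Ω} (h : E ≤ E') (h' : E' ≤ E'') :
    transition f (h.trans h') = transition f h' ≫ transition f h := by
  apply pullback.hom_ext
  · rw [Category.assoc, transition_fst, transition_fst, transition_fst]
  · rw [Category.assoc, transition_snd, transition_snd, reassoc_of% (transition_snd f h'),
      specInclusion_trans]

lemma toBaseChange_transition {E E' : IntermediateField k Ω} (h : E ≤ E') :
    toBaseChange f E' ≫ transition f h = toBaseChange f E := by
  apply pullback.hom_ext
  · rw [Category.assoc, transition_fst, toBaseChange_fst, toBaseChange_fst]
  · rw [Category.assoc, transition_snd, reassoc_of% (toBaseChange_snd f E'), toBaseChange_snd,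
      algebraMap_comp_specInclusion]

instance isAffineHom_transition {E E' : IntermediateField k Ω} (h : E ≤ E') :
    IsAffineHom (transition f h) := by
  have (E : IntermediateField k Ω) :
      IsAffineHom (pullback.fst f (Spec.map (CommRingCat.ofHom (algebraMap k E)))) :=
    isAffineHom_pullback_fst _ _
  have : IsAffineHom (transition f h ≫ pullback.fst _ _) := by
    rw [transition_fst]
    infer_instance
  exact IsAffineHom.of_comp _ (pullback.fst f (Spec.map (CommRingCat.ofHom (algebraMap k E))))

/-- The diagram of the schemes `X_E`. -/
def schemeDiagram : (FiniteOver L)ᵒᵖ ⥤ Scheme.{u} where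
  obj E := pullback f (Spec.map (CommRingCat.ofHom (algebraMap k E.unop.1)))
  map φ := transition f (leOfHom φ.unop)
  map_id E := transition_refl f E.unop.1
  map_comp φ ψ := transition_trans f (leOfHom ψ.unop) (leOfHom φ.unop)

/-- The scheme `X_Ω` as a cone over the schemes `X_E`. -/
def schemeCone : Cone (schemeDiagram L f) where
  pt := pullback f (Spec.map (CommRingCat.ofHom (algebraMap k Ω)))
  π :=
    { app E := toBaseChange f E.unop.1
      naturality _ _ φ := (Category.id_comp _).trans
        (toBaseChange_transition f (leOfHom φ.unop)).symm }

/-- The scheme `Spec Ω` is the limit of the schemes `Spec E`. -/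
def isLimitSpecCone [Algebra.IsAlgebraic k Ω] [FiniteDimensional k L] :
    IsLimit (Scheme.Spec.mapCone (ringCocone L).op) :=
  isLimitOfPreserves Scheme.Spec (isColimitRingCocone L).op

variable {L} in
/-- The second components of a cone over the schemes `X_E` form a cone over the `Spec E`. -/
def specConeOf (s : Cone (schemeDiagram L f)) : Cone ((ringDiagram L).op ⋙ Scheme.Spec) where
  pt := s.pt
  π :=
    { app E := s.π.app E ≫
        pullback.snd f (Spec.map (CommRingCat.ofHom (algebraMap k E.unop.1)))
      naturality E E' φ := by
        refine (Category.id_comp _).trans ?_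
        rw [← s.w φ]
        exact (Category.assoc _ _ _).trans ((congrArg (fun t => s.π.app E ≫ t)
          (transition_snd f (leOfHom φ.unop))).trans (Category.assoc _ _ _).symm) }

/-- The scheme `X_Ω` is the limit of the schemes `X_E`. -/
def isLimitSchemeCone [Algebra.IsAlgebraic k Ω] [FiniteDimensional k L] :
    IsLimit (schemeCone L f) := by
  -- The component in X of a cone does not depend on the index E; the least index L serves to name
  -- it.
  let E₀ : FiniteOver L := ⟨L, inferInstance, le_rfl⟩
  have hfst (s : Cone (schemeDiagram L f)) (E : FiniteOver L) :
      (s.π.app (.op E) ≫ pullback.fst f (Spec.map (CommRingCat.ofHom (algebraMap k E.1))) :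
        s.pt ⟶ X) =
      s.π.app (.op E₀) ≫ pullback.fst f (Spec.map (CommRingCat.ofHom (algebraMap k L))) := by
    rw [← s.w (homOfLE (show E₀ ≤ E from E.2.2)).op]
    exact ((Category.assoc _ _ _).trans (congrArg (fun t => s.π.app (.op E) ≫ t)
      (transition_fst f E.2.2))).symm
  have hsnd (s : Cone (schemeDiagram L f)) (E : FiniteOver L) :
      ((isLimitSpecCone L).lift (specConeOf f s) : s.pt ⟶ Spec (CommRingCat.of Ω)) ≫
        Spec.map (CommRingCat.ofHom (algebraMap E.1 Ω)) =
      s.π.app (.op E) ≫ pullback.snd f (Spec.map (CommRingCat.ofHom (algebraMap k E.1))) :=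
    (isLimitSpecCone L).fac (specConeOf f s) (.op E)
  refine
    { lift s := pullback.lift
        (s.π.app (.op E₀) ≫ pullback.fst f (Spec.map (CommRingCat.ofHom (algebraMap k L))))
        ((isLimitSpecCone L).lift (specConeOf f s)) ?_
      fac s E := ?_
      uniq s m hm := ?_ }
  · rw [← spec_condition L]
    have := congrArg (fun t => t ≫ Spec.map (CommRingCat.ofHom (algebraMap k L))) (hsnd s E₀)
    refine Eq.trans ?_ ((Category.assoc _ _ _).symm.trans this).symm
    exact (Category.assoc _ _ _).trans ((congrArg (fun t => s.π.app (.op E₀) ≫ t)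
      pullback.condition).trans (Category.assoc _ _ _).symm)
  · apply pullback.hom_ext
    · refine (Category.assoc _ _ _).trans ((congrArg _ (toBaseChange_fst f E.unop.1)).trans ?_)
      exact (pullback.lift_fst _ _ _).trans (hfst s E.unop).symm
    · refine (Category.assoc _ _ _).trans ((congrArg _ (toBaseChange_snd f E.unop.1)).trans ?_)
      refine (Category.assoc _ _ _).symm.trans ?_
      exact (congrArg (fun t => t ≫ _) (pullback.lift_snd _ _ _)).trans (hsnd s E.unop)
  · apply pullback.hom_ext
    · refine Eq.trans ?_ (pullback.lift_fst _ _ _).symm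
      rw [← hm (.op E₀)]
      exact ((Category.assoc _ _ _).trans (congrArg _ (toBaseChange_fst f L))).symm
    · refine Eq.trans ?_ (pullback.lift_snd _ _ _).symm
      refine (isLimitSpecCone L).hom_ext fun E => ?_
      refine Eq.trans ?_ (hsnd s E.unop).symm
      rw [← hm (.op E.unop)]
      exact (Category.assoc _ _ _).trans ((congrArg (fun t => m ≫ t)
        (toBaseChange_snd f E.unop.1).symm).trans (Category.assoc _ _ _).symm)

/-- A morphism from `X_Ω` to a scheme locally of finite presentation over `L` is defined over a
finite extension of `L`. -/
theorem exists_toBaseChange_comp_eq [Algebra.IsAlgebraic k Ω] [FiniteDimensional k L]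
    [QuasiCompact f] [QuasiSeparated f] {Y : Scheme.{u}} (g : Y ⟶ Spec (CommRingCat.of L))
    [LocallyOfFinitePresentation g]
    (a : pullback f (Spec.map (CommRingCat.ofHom (algebraMap k Ω))) ⟶ Y)
    (ha : a ≫ g = pullback.snd _ _ ≫ Spec.map (CommRingCat.ofHom (algebraMap L Ω))) :
    ∃ (E : IntermediateField k Ω) (_ : FiniteDimensional k E) (_ : L ≤ E)
      (b : pullback f (Spec.map (CommRingCat.ofHom (algebraMap k E))) ⟶ Y),
      toBaseChange f E ≫ b = a := by
  have := nonempty L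
  have (E : (FiniteOver L)ᵒᵖ) : CompactSpace ((schemeDiagram L f).obj E) :=
    compactSpace_pullback f (Spec.map (CommRingCat.ofHom (algebraMap k E.unop.1)))
  have (E : (FiniteOver L)ᵒᵖ) : QuasiSeparatedSpace ((schemeDiagram L f).obj E) :=
    quasiSeparatedSpace_pullback f (Spec.map (CommRingCat.ofHom (algebraMap k E.unop.1)))
  have {E E' : (FiniteOver L)ᵒᵖ} (φ : E ⟶ E') : IsAffineHom ((schemeDiagram L f).map φ) :=
    isAffineHom_transition f (leOfHom φ.unop)
  let t : schemeDiagram L f ⟶ (Functor.const (FiniteOver L)ᵒᵖ).obj (Spec (CommRingCat.of L)) :=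
    { app E := pullback.snd f (Spec.map (CommRingCat.ofHom (algebraMap k E.unop.1))) ≫
        specInclusion E.unop.2.2
      naturality E E' φ := by
        refine Eq.trans ?_ (Category.comp_id _).symm
        refine (Category.assoc _ _ _).symm.trans ?_
        refine (congrArg (fun t => t ≫ specInclusion E'.unop.2.2)
          (transition_snd f (leOfHom φ.unop))).trans ?_
        exact (Category.assoc _ _ _).trans (congrArg (fun t => pullback.snd _ _ ≫ t)
          (specInclusion_trans E'.unop.2.2 (leOfHom φ.unop)).symm) }
  -- X_Ω is a cofiltered limit of quasi-compact quasi-separated schemes with affine transition maps,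
  -- so finite presentation of Y makes the morphism factor through a finite level.
  obtain ⟨E, b, hb, -⟩ := Scheme.exists_π_app_comp_eq_of_locallyOfFinitePresentation
    (schemeDiagram L f) t g (schemeCone L f) (isLimitSchemeCone L f) a (by
      ext E : 2
      refine Eq.trans ?_ ha.symm
      refine (Category.assoc _ _ _).symm.trans ?_
      refine (congrArg (fun t => t ≫ specInclusion E.unop.2.2)
        (toBaseChange_snd f E.unop.1)).trans ?_
      exact (Category.assoc _ _ _).trans (congrArg (fun t => pullback.snd _ _ ≫ t)
          (algebraMap_comp_specInclusion E.unop.2.2)))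
  exact ⟨E.unop.1, E.unop.2.1, E.unop.2.2, b, hb⟩

/-- Since u is the identity on E, it acts trivially after projection to X_E, so whatever factors
through X_E is invariant under u. -/
lemma comp_toBaseChange_eq (E : IntermediateField k Ω) (u : Ω ≃ₐ[k] Ω)
    (hu : u ∈ E.fixingSubgroup)
    (h : Spec.map (CommRingCat.ofHom (u : Ω →+* Ω)) ≫
      Spec.map (CommRingCat.ofHom (algebraMap k Ω)) =
        Spec.map (CommRingCat.ofHom (algebraMap k Ω))) :
    (pullbackCompIso f _ _ _ h).hom ≫ toBaseChange f E = pullback.fst _ _ ≫ toBaseChange f E := by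
  apply pullback.hom_ext
  · rw [Category.assoc, Category.assoc, toBaseChange_fst, pullbackCompIso_hom_fst]
  · rw [Category.assoc, Category.assoc, toBaseChange_snd,
      reassoc_of% (pullbackCompIso_hom_snd f _ _ _ h), pullback.condition_assoc, ← Spec.map_comp]
    congr 3
    ext x
    exact (hu x).symm

end FiniteOver

lemma comp_fst_comp_of_comp_snd {X Y S S' T : Scheme.{u}} (f : X ⟶ S) (a : T ⟶ S) (y : Y ⟶ S')
    (c : T ⟶ S') (g : pullback f a ⟶ pullback y c)
    (hg : g ≫ pullback.snd y c = pullback.snd f a) :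
    (g ≫ pullback.fst y c) ≫ y = pullback.snd f a ≫ c := by
  rw [Category.assoc, pullback.condition, reassoc_of% hg]

/-- The second components agree automatically because g is a morphism over T; equivariance is thus
only the invariance `hinv` of the component in Y. -/
lemma comp_pullbackCompIso_eq {X Y S S' T : Scheme.{u}} (f : X ⟶ S) (a : T ⟶ S) (y : Y ⟶ S')
    (c : T ⟶ S') (v : T ⟶ T) (h : v ≫ a = a) (h' : v ≫ c = c) (g : pullback f a ⟶ pullback y c)
    (hg : g ≫ pullback.snd y c = pullback.snd f a)
    (w : pullback (pullback.snd f a) v ⟶ pullback (pullback.snd y c) v)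
    (hw₁ : w ≫ pullback.fst _ _ = pullback.fst _ _ ≫ g)
    (hw₂ : w ≫ pullback.snd _ _ = pullback.snd _ _)
    (hinv : (pullbackCompIso f a v a h).hom ≫ g ≫ pullback.fst y c =
      pullback.fst _ _ ≫ g ≫ pullback.fst y c) :
    w ≫ (pullbackCompIso y c v c h').hom = (pullbackCompIso f a v a h).hom ≫ g := by
  apply pullback.hom_ext
  · rw [Category.assoc, pullbackCompIso_hom_fst, Category.assoc, hinv, reassoc_of% hw₁]
  · rw [Category.assoc, pullbackCompIso_hom_snd, Category.assoc, hg, hw₂, pullbackCompIso_hom_snd]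

/-- A homomorphism from `A_Ω` to `M_Ω` is compatible with the canonical descent isomorphisms for
all `u` fixing a suitable finite extension. -/
theorem exists_baseChange_map_comp [Algebra.IsAlgebraic k Ω] {L : IntermediateField k Ω}
    [FiniteDimensional k L] (A : GrpSch k) [QuasiCompact A.X.hom] [QuasiSeparated A.X.hom]
    (M : GrpSch L) [LocallyOfFinitePresentation M.X.hom]
    (g : (baseChange (algebraMap k Ω)).obj A ⟶ (baseChange (algebraMap L Ω)).obj M) :
    ∃ (E : IntermediateField k Ω) (_ : FiniteDimensional k E), L ≤ E ∧
      ∀ (u : Ω ≃ₐ[k] Ω) (_ : u ∈ E.fixingSubgroup)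
        (hM : (u : Ω →+* Ω).comp (algebraMap L Ω) = algebraMap L Ω)
        (hA : (u : Ω →+* Ω).comp (algebraMap k Ω) = algebraMap k Ω),
      (baseChange (u : Ω →+* Ω)).map g ≫
          (baseChangeComp (algebraMap L Ω) (u : Ω →+* Ω) (algebraMap L Ω) hM).hom.app M =
        (baseChangeComp (algebraMap k Ω) (u : Ω →+* Ω) (algebraMap k Ω) hA).hom.app A ≫ g := by
  obtain ⟨E, hE, hLE, b, hb⟩ := FiniteOver.exists_toBaseChange_comp_eq L A.X.hom M.X.hom
    (g.hom.hom.hom.left ≫ pullback.fst M.X.hom (Spec.map (CommRingCat.ofHom (algebraMap L Ω))))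
    (comp_fst_comp_of_comp_snd _ _ _ _ _ (Over.w g.hom.hom.hom))
  refine ⟨E, hE, hLE, fun u hu hM hA => ?_⟩
  have eM : Spec.map (CommRingCat.ofHom (u : Ω →+* Ω)) ≫
      Spec.map (CommRingCat.ofHom (algebraMap L Ω)) =
        Spec.map (CommRingCat.ofHom (algebraMap L Ω)) := by
    rw [← Spec.map_comp, ← CommRingCat.ofHom_comp, hM]
  have eA : Spec.map (CommRingCat.ofHom (u : Ω →+* Ω)) ≫
      Spec.map (CommRingCat.ofHom (algebraMap k Ω)) =
        Spec.map (CommRingCat.ofHom (algebraMap k Ω)) := by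
    rw [← Spec.map_comp, ← CommRingCat.ofHom_comp, hA]
  apply CommGrp.hom_ext
  apply Over.OverMorphism.ext
  have EM := baseChangeComp_left _ _ _ hM M eM
  have EA := baseChangeComp_left _ _ _ hA A eA
  change ((baseChange (u : Ω →+* Ω)).map g).hom.hom.hom.left ≫
      ((baseChangeComp (algebraMap L Ω) (u : Ω →+* Ω) (algebraMap L Ω) hM).hom.app M
        ).hom.hom.hom.left =
    ((baseChangeComp (algebraMap k Ω) (u : Ω →+* Ω) (algebraMap k Ω) hA).hom.app A
        ).hom.hom.hom.left ≫ g.hom.hom.hom.left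
  rw [EM, EA, baseChange_map_left]
  have F₁ := overPullback_map_fst (Spec.map (CommRingCat.ofHom (u : Ω →+* Ω))) g.hom.hom.hom
  have F₂ := overPullback_map_snd (Spec.map (CommRingCat.ofHom (u : Ω →+* Ω))) g.hom.hom.hom
  refine comp_pullbackCompIso_eq _ _ _ _ _ eA eM _ (Over.w g.hom.hom.hom) _ F₁ F₂ ?_
  -- The component of g in M factors through A_E, where u acts trivially.
  have := congrArg (fun t => t ≫ b) (FiniteOver.comp_toBaseChange_eq A.X.hom E u hu eA)
  simp only [Category.assoc, hb] at this
  exact this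

instance IsAbelianVariety.locallyOfFinitePresentation {K : Type u} [Field K] (A : GrpSch K)
    [h : IsAbelianVariety A] : LocallyOfFinitePresentation A.X.hom :=
  have := h.isProper
  inferInstanceAs (LocallyOfFinitePresentation (Y := Spec (CommRingCat.of K)) A.X.hom)

/-- A morphism up to isogeny from `A_Ω` to `B` is compatible with the descent isomorphisms of `A`
and of a model of `B`, for all `u` fixing a suitable finite extension. -/
theorem exists_conj_map_comp_descentIso [Algebra.IsAlgebraic k Ω] {L : IntermediateField k Ω}
    [FiniteDimensional k L] (A : GrpSch k) [hA : IsAbelianVariety A] {B : GrpSch Ω}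
    (m : Model k B L) (h : geometricFiber (Ω := Ω) A ⟶ ⟨B⟩) :
    ∃ (E : IntermediateField k Ω) (_ : FiniteDimensional k E), L ≤ E ∧
      ∀ (u : Ω ≃ₐ[k] Ω) (_ : u ∈ E.fixingSubgroup) (hu : u ∈ L.fixingSubgroup),
      (conj u).map h ≫ (m.descentIso u hu).hom = (canonicalDescent A u).hom ≫ h := by
  change ℚ ⊗[ℤ] ((baseChange (algebraMap k Ω)).obj A ⟶ B) at h
  induction h with
  | zero =>
    refine ⟨L, inferInstance, le_rfl, fun u _ hu => ?_⟩
    change (conj u).map (0 : geometricFiber (Ω := Ω) A ⟶ ⟨B⟩) ≫ _ =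
      (canonicalDescent A u).hom ≫ (0 : geometricFiber (Ω := Ω) A ⟶ ⟨B⟩)
    rw [Functor.map_zero, zero_comp, comp_zero]
  | add x y hx hy =>
    obtain ⟨E, hE, hLE, h₁⟩ := hx
    obtain ⟨E', hE', hLE', h₂⟩ := hy
    -- A sum of pure tensors needs only finitely many fields of definition; their compositum is
    -- still finite.
    refine ⟨E ⊔ E', inferInstance, hLE.trans le_sup_left, fun u hu hu' => ?_⟩
    have e₁ := h₁ u (IntermediateField.fixingSubgroup_antitone le_sup_left hu) hu'
    have e₂ := h₂ u (IntermediateField.fixingSubgroup_antitone le_sup_right hu) hu'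
    change geometricFiber (Ω := Ω) A ⟶ ⟨B⟩ at x y
    change (conj u).map (x + y) ≫ _ = (canonicalDescent A u).hom ≫ (x + y)
    rw [Functor.map_add, Preadditive.add_comp, Preadditive.comp_add, e₁, e₂]
  | tmul q h =>
    have := hA.isProper
    have := m.isAbelianVariety
    -- The model isomorphism is composed in first, so that the target is a base change from L and of
    -- finite presentation there.
    obtain ⟨E, hE, hLE, H⟩ := exists_baseChange_map_comp A m.obj (h ≫ m.iso.inv)
    refine ⟨E, hE, hLE, fun u hu hu' => ?_⟩
    have e := H u hu (RingHom.ext fun x => hu' x) (RingHom.ext fun x => u.commutes x)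
    have e' := congrArg (fun t => t ≫ m.iso.hom) e
    simp only [Functor.map_comp, Category.assoc, Iso.inv_hom_id, Category.comp_id] at e'
    have hl : (conj u).map (q ⊗ₜ h : geometricFiber (Ω := Ω) A ⟶ ⟨B⟩) ≫ (m.descentIso u hu').hom =
      ((q * 1) ⊗ₜ[ℤ] ((baseChange (u : Ω →+* Ω)).map h ≫ (baseChange (u : Ω →+* Ω)).map m.iso.inv ≫
        (baseChangeComp (algebraMap L Ω) (u : Ω →+* Ω) (algebraMap L Ω)
          (RingHom.ext fun x => hu' x)).hom.app m.obj ≫ m.iso.hom) :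
        ℚ ⊗[ℤ] ((baseChange (u : Ω →+* Ω)).obj ((baseChange (algebraMap k Ω)).obj A) ⟶ B)) := rfl
    have hr : (canonicalDescent A u).hom ≫ (q ⊗ₜ h : geometricFiber (Ω := Ω) A ⟶ ⟨B⟩) =
      ((1 * q) ⊗ₜ[ℤ] ((baseChangeComp (algebraMap k Ω) (u : Ω →+* Ω) (algebraMap k Ω)
          (RingHom.ext fun x => u.commutes x)).hom.app A ≫ h) :
        ℚ ⊗[ℤ] ((baseChange (u : Ω →+* Ω)).obj ((baseChange (algebraMap k Ω)).obj A) ⟶ B)) := rfl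
    rw [hl, hr, e', mul_comm]

/-- If a power of `B` has a model over `k` up to isogeny, then the cocycle of `B` becomes trivial
up to a locally constant system of matrices over `End⁰(B)`. -/
theorem CompatibleSystem.exists_matrix [Algebra.IsAlgebraic k Ω] {B : GrpSch Ω}
    (μ : CompatibleSystem k B) {n : ℕ} (h : HasModelUpToIsogeny k (power B n)) :
    ∃ M : (Ω ≃ₐ[k] Ω) → Matrix (Fin n) (Fin n) (End0 B), IsLocallyConstant M ∧
      (∀ σ, IsUnit (M σ)) ∧ ∀ σ τ, M (σ * τ) =
        Matrix.scalar (Fin n) ((μ.cocycle σ τ : Subring.center (End0 B)) : End0 B) *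
          (M σ * M τ) := by
  obtain ⟨A, hA, ⟨e⟩⟩ := h
  have hp : IsPower (geometricFiber (Ω := Ω) A) (⟨B⟩ : Isog (GrpSch Ω)) n :=
    ((isPower_power B n).map (Isog.ofHom (GrpSch Ω))).of_iso e
  obtain ⟨a, b, h₁, h₂⟩ := hp
  refine ⟨μ.descentMatrix a b, ?_, μ.isUnit_descentMatrix h₁ h₂, μ.descentMatrix_mul h₂⟩
  obtain ⟨L, hL, m, hm⟩ := μ.locallyConstant
  choose E hE hLE H using fun i => exists_conj_map_comp_descentIso A m (a i)
  -- This field contains the field of the model and fields over which all n projections are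
  -- equivariant.
  let E' : IntermediateField k Ω := L ⊔ ⨆ i, E i
  have hE' : FiniteDimensional k E' := inferInstance
  have hconst (σ u : Ω ≃ₐ[k] Ω) (hu : u ∈ E'.fixingSubgroup) :
      μ.descentMatrix a b (σ * u) = μ.descentMatrix a b σ := by
    have huL : u ∈ L.fixingSubgroup := IntermediateField.fixingSubgroup_antitone le_sup_left hu
    refine μ.descentMatrix_mul_right h₁ h₂ u (m.descentIso u huL) (fun i => H i u ?_ huL) σ
      (hm σ u huL).1
    exact IntermediateField.fixingSubgroup_antitone ((le_iSup E i).trans le_sup_right) hu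
  rw [IsLocallyConstant.iff_exists_open]
  intro σ
  refine ⟨(fun x => σ⁻¹ * x) ⁻¹' (E'.fixingSubgroup : Set (Ω ≃ₐ[k] Ω)),
    E'.fixingSubgroup_isOpen.preimage (continuous_const_mul _), by simp, fun τ hτ => ?_⟩
  have := hconst σ _ hτ
  rwa [mul_inv_cancel_left] at this

end Spreading

/-! ### Images of homomorphisms and simple abelian varieties. -/

section SubgroupObject

open MonObj GrpObj

variable {C : Type u} [Category.{v} C] [CartesianMonoidalCategory C]

/-- The group structure on a subobject that is stable under the group operations. -/
abbrev grpObjOfMono {G Y : C} [GrpObj G] (i : Y ⟶ G) [Mono i] (e : 𝟙_ C ⟶ Y) (m : Y ⊗ Y ⟶ Y)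
    (v : Y ⟶ Y) (he : e ≫ i = η) (hm : m ≫ i = (i ⊗ₘ i) ≫ μ) (hv : v ≫ i = i ≫ ι) : GrpObj Y :=
  have hl {T : C} (a b : T ⟶ Y) : lift a b ≫ m ≫ i = lift (a ≫ i) (b ≫ i) ≫ μ := by
    rw [hm, lift_map_assoc]
  { one := e
    mul := m
    inv := v
    one_mul := by
      have h : e ▷ Y = lift (fst _ _ ≫ e) (snd _ _) := by
        apply CartesianMonoidalCategory.hom_ext <;> simp
      rw [← cancel_mono i, Category.assoc, h, hl, Category.assoc, he, lift_comp_one_left,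
        CartesianMonoidalCategory.leftUnitor_hom]
    mul_one := by
      have h : Y ◁ e = lift (fst _ _) (snd _ _ ≫ e) := by
        apply CartesianMonoidalCategory.hom_ext <;> simp
      rw [← cancel_mono i, Category.assoc, h, hl, Category.assoc, he, lift_comp_one_right,
        CartesianMonoidalCategory.rightUnitor_hom]
    mul_assoc := by
      have h₁ : m ▷ Y = lift (lift (fst _ _ ≫ fst _ _) (fst _ _ ≫ snd _ _) ≫ m) (snd _ _) := by
        apply CartesianMonoidalCategory.hom_ext
        · rw [lift_fst, whiskerRight_fst]
          congr 1
          apply CartesianMonoidalCategory.hom_ext <;> simp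
        · simp
      have h₂ : (α_ Y Y Y).hom ≫ Y ◁ m = lift (fst _ _ ≫ fst _ _)
          (lift (fst _ _ ≫ snd _ _) (snd _ _) ≫ m) := by
        apply CartesianMonoidalCategory.hom_ext
        · simp
        · rw [lift_snd, Category.assoc, whiskerLeft_snd, ← Category.assoc]
          congr 1
          apply CartesianMonoidalCategory.hom_ext <;> simp
      rw [← cancel_mono i, Category.assoc, Category.assoc, Category.assoc,
        ← Category.assoc (α_ Y Y Y).hom, h₁, h₂, hl, hl, Category.assoc (lift _ _) m i,
        Category.assoc (lift _ _) m i, hl, hl, lift_lift_assoc]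
    left_inv := by
      rw [← cancel_mono i, Category.assoc, hl, hv, Category.id_comp, lift_comp_inv_left,
        Category.assoc, he]
    right_inv := by
      rw [← cancel_mono i, Category.assoc, hl, hv, Category.id_comp, lift_comp_inv_right,
        Category.assoc, he] }

end SubgroupObject

section Image

/-- The image of X → im f is closed in Y and f still factors through it, so it has the same ideal as
im f and is all of it. -/
lemma isSchemeTheoreticallyDominant_toImage {X Y : Scheme.{u}} (f : X ⟶ Y) :
    IsSchemeTheoreticallyDominant f.toImage := by
  have h : IsIso f.toImage.imageι := by
    refine IsClosedImmersion.isIso_of_ker_eq (f.toImage.imageι ≫ f.imageι) f.imageι _ rfl ?_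
    refine le_antisymm ?_ (Scheme.Hom.le_ker_comp _ _)
    have := Scheme.Hom.le_ker_comp f.toImage.toImage (f.toImage.imageι ≫ f.imageι)
    rwa [Scheme.Hom.toImage_imageι_assoc, Scheme.Hom.toImage_imageι,
      ← f.ker.ker_subschemeι] at this
  exact ⟨(Scheme.isIso_subschemeι_iff_eq_bot _).1 h⟩

/-- Precomposing with a schematically dominant q does not change the kernel ideal of h, so the ideal
of Y already vanishes on W. This is how the group operations are restricted to an image. -/
lemma exists_comp_eq_of_isSchemeTheoreticallyDominant {W X Y Z : Scheme.{u}} (q : Z ⟶ W)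
    [IsSchemeTheoreticallyDominant q] (i : Y ⟶ X) [IsClosedImmersion i] (h : W ⟶ X) (r : Z ⟶ Y)
    (e : q ≫ h = r ≫ i) : ∃ l : W ⟶ Y, l ≫ i = h := by
  have hk : i.ker ≤ h.ker := by
    have h₁ := Scheme.Hom.ker_comp q h
    rw [q.ker_eq_bot, Scheme.IdealSheafData.map_bot, e] at h₁
    rw [← h₁]
    exact Scheme.Hom.le_ker_comp _ _
  exact ⟨IsClosedImmersion.lift i h hk, IsClosedImmersion.lift_fac _ _ _⟩

lemma exists_over_comp_eq_of_isSchemeTheoreticallyDominant {S : Scheme.{u}} {W X Y Z : Over S}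
    (q : Z ⟶ W) [IsSchemeTheoreticallyDominant q.left] (i : Y ⟶ X) [IsClosedImmersion i.left]
    (h : W ⟶ X) (r : Z ⟶ Y) (e : q ≫ h = r ≫ i) : ∃ l : W ⟶ Y, l ≫ i = h := by
  obtain ⟨l, hl⟩ := exists_comp_eq_of_isSchemeTheoreticallyDominant q.left i.left h.left r.left
    (congrArg CommaMorphism.left e)
  refine ⟨Over.homMk l ?_, Over.OverMorphism.ext hl⟩
  rw [← Over.w i, ← Category.assoc, hl, Over.w]

/-- Write p × p as (1 × p) ∘ (p × 1). Each factor is a flat base change of the quasi-compact p, and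
schematic dominance survives such base change. -/
lemma isSchemeTheoreticallyDominant_pullback_map {X Y S : Scheme.{u}} (p : X ⟶ Y) (x : X ⟶ S)
    (y : Y ⟶ S) (h : p ≫ y = x) [IsSchemeTheoreticallyDominant p] [QuasiCompact p]
    [Flat x] [Flat y] (w : pullback x x ⟶ pullback y y)
    (hw₁ : w ≫ pullback.fst y y = pullback.fst x x ≫ p)
    (hw₂ : w ≫ pullback.snd y y = pullback.snd x x ≫ p) :
    IsSchemeTheoreticallyDominant w := by
  let w₁ : pullback x x ⟶ pullback y x :=
    pullback.lift (pullback.fst x x ≫ p) (pullback.snd x x)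
      (by rw [Category.assoc, h, pullback.condition])
  let w₂ : pullback y x ⟶ pullback y y :=
    pullback.lift (pullback.fst y x) (pullback.snd y x ≫ p)
      (by rw [Category.assoc, h, pullback.condition])
  have hw : w = w₁ ≫ w₂ := by
    apply pullback.hom_ext
    · rw [hw₁, Category.assoc, pullback.lift_fst, pullback.lift_fst]
    · rw [hw₂, Category.assoc, pullback.lift_snd, pullback.lift_snd_assoc]
  have h₁ : IsPullback (pullback.fst x x) w₁ p (pullback.fst y x) := by
    refine (IsPullback.of_right ?_ (pullback.lift_fst _ _ _)
      (IsPullback.of_hasPullback y x).flip).flip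
    rw [pullback.lift_snd, h]
    exact (IsPullback.of_hasPullback x x).flip
  have h₂ : IsPullback (pullback.snd y x) w₂ p (pullback.snd y y) := by
    refine (IsPullback.of_right ?_ (pullback.lift_snd _ _ _)
      (IsPullback.of_hasPullback y y)).flip
    rw [pullback.lift_fst, h]
    exact IsPullback.of_hasPullback y x
  have := IsSchemeTheoreticallyDominant.of_isPullback h₁
  have := IsSchemeTheoreticallyDominant.of_isPullback h₂
  rw [hw]
  infer_instance

/-- After a field extension, which is flat, Y is still the target of a schematically dominant
morphism from an integral scheme; it inherits reducedness and irreducibility. -/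
lemma geometricallyIntegral_of_isSchemeTheoreticallyDominant {K : Type u} [Field K]
    {X Y : Scheme.{u}} (p : X ⟶ Y) (y : Y ⟶ Spec (CommRingCat.of K))
    [IsSchemeTheoreticallyDominant p] [QuasiCompact p] [GeometricallyIntegral (p ≫ y)] :
    GeometricallyIntegral y := by
  refine ⟨fun L _ a Z z₁ z₂ H => ?_⟩
  have hZ : Flat z₁ := MorphismProperty.of_isPullback (P := @Flat) H.flip inferInstance
  have hX : IsIntegral (pullback p z₁) := by
    have H' : IsPullback (pullback.fst p z₁) (pullback.snd p z₁ ≫ z₂) (p ≫ y) a :=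
      (IsPullback.of_hasPullback p z₁).flip.paste_horiz H.flip |>.flip
    exact GeometricallyIntegral.geometrically_isIntegral (f := p ≫ y) a _ _ H'
  have hq : IsSchemeTheoreticallyDominant (pullback.snd p z₁) := inferInstance
  have hr : IsReduced Z := IsSchemeTheoreticallyDominant.isReduced (pullback.snd p z₁)
  have hd : IsDominant (pullback.snd p z₁) := inferInstance
  rw [isIntegral_iff_irreducibleSpace_and_isReduced]
  refine ⟨?_, hr⟩
  rw [irreducibleSpace_def, Set.top_eq_univ, ← hd.denseRange.closure_eq, ← Set.image_univ]
  exact ((IrreducibleSpace.isIrreducible_univ _).image _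
    (pullback.snd p z₁).continuous.continuousOn).closure

end Image

section Simple

variable {K : Type u} [Field K]

lemma IsAbelianVariety.isIntegral (A : GrpSch K) [h : IsAbelianVariety A] :
    IsIntegral A.X.left :=
  have := h.geometricallyIntegral
  GeometricallyIntegral.isIntegral_of_subsingleton (S := Spec (CommRingCat.of K)) A.X.hom

/-- A is reduced and B is separated, so agreement on a dense part is agreement everywhere. -/
lemma eq_of_isDominant_comp_eq {A B : GrpSch K} [hA : IsAbelianVariety A]
    [hB : IsAbelianVariety B] {T : Scheme.{u}} (t : T ⟶ A.X.left) [IsDominant t] (f g : A ⟶ B)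
    (h : t ≫ f.hom.hom.hom.left = t ≫ g.hom.hom.hom.left) : f = g := by
  have := IsAbelianVariety.isIntegral A
  have := hB.isProper
  apply CommGrp.hom_ext
  apply Over.OverMorphism.ext
  refine ext_of_isDominant_of_isSeparated (X := A.X.left) (Y := B.X.left) B.X.hom ?_ t h
  exact (Over.w f.hom.hom.hom).trans (Over.w g.hom.hom.hom).symm

/-- A homomorphism of abelian varieties factors as a dominant homomorphism onto an abelian
subvariety followed by its inclusion. -/
theorem exists_image {A B : GrpSch K} [hA : IsAbelianVariety A] [hB : IsAbelianVariety B]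
    (f : A ⟶ B) :
    ∃ (Y : GrpSch K) (p : A ⟶ Y) (i : Y ⟶ B), IsAbelianVariety Y ∧
      IsClosedImmersion i.hom.hom.hom.left ∧ IsDominant p.hom.hom.hom.left ∧ p ≫ i = f := by
  have := hA.isProper
  have := hA.geometricallyIntegral
  have := hB.isProper
  let φ : A.X ⟶ B.X := f.hom.hom.hom
  have hφ : IsMonHom φ := f.hom.hom.isMonHom_hom
  let Y : Over (Spec (CommRingCat.of K)) := Over.mk (φ.left.imageι ≫ B.X.hom)
  let p : A.X ⟶ Y := Over.homMk φ.left.toImage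
    (by
      change φ.left.toImage ≫ φ.left.imageι ≫ B.X.hom = A.X.hom
      rw [Scheme.Hom.toImage_imageι_assoc, Over.w])
  let i : Y ⟶ B.X := Over.homMk φ.left.imageι
  have hi : IsClosedImmersion i.left := inferInstanceAs (IsClosedImmersion φ.left.imageι)
  have hi' : Mono i.left := inferInstance
  have him : Mono i := Over.mono_of_mono_left i
  have hp : IsSchemeTheoreticallyDominant p.left := isSchemeTheoreticallyDominant_toImage φ.left
  have hpi : p ≫ i = φ := Over.OverMorphism.ext (Scheme.Hom.toImage_imageι φ.left)
  have hYp : IsProper Y.hom := inferInstanceAs (IsProper (φ.left.imageι ≫ B.X.hom))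
  have hpc : QuasiCompact p.left := by
    have : QuasiCompact (p.left ≫ Y.hom) := by rw [Over.w]; infer_instance
    exact QuasiCompact.of_comp p.left Y.hom
  have hYi : GeometricallyIntegral Y.hom := by
    have : GeometricallyIntegral (p.left ≫ Y.hom) := by rw [Over.w]; infer_instance
    exact geometricallyIntegral_of_isSchemeTheoreticallyDominant p.left Y.hom
  have hpp : IsSchemeTheoreticallyDominant (p ⊗ₘ p).left := by
    refine isSchemeTheoreticallyDominant_pullback_map p.left A.X.hom Y.hom (Over.w p) _ ?_ ?_
    · exact Over.tensorHom_left_fst _ _ p p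
    · exact Over.tensorHom_left_snd _ _ p p
  -- Products of points of the image lie in the image: this holds after the dominant cover p × p,
  -- where it is multiplicativity of the original homomorphism. The inverse is treated the same way.
  obtain ⟨m, hm⟩ := exists_over_comp_eq_of_isSchemeTheoreticallyDominant (p ⊗ₘ p) i
    ((i ⊗ₘ i) ≫ MonObj.mul) (MonObj.mul ≫ p) (by
      rw [tensorHom_comp_tensorHom_assoc, hpi, Category.assoc, hpi, IsMonHom.mul_hom])
  obtain ⟨v, hv⟩ := exists_over_comp_eq_of_isSchemeTheoreticallyDominant p i
    (i ≫ GrpObj.inv) (GrpObj.inv ≫ p) (by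
      rw [← Category.assoc, hpi, Category.assoc, hpi, GrpObj.inv_hom φ])
  have he : ((MonObj.one : 𝟙_ _ ⟶ A.X) ≫ p) ≫ i = MonObj.one := by
    rw [Category.assoc, hpi, IsMonHom.one_hom]
  let G : GrpObj Y := grpObjOfMono i _ m v he hm hv
  -- Properness and geometric integrality alone force commutativity.
  have hc : IsCommMonObj Y := isCommMonObj_of_isProper_of_geometricallyIntegral Y
  have hmi : IsMonHom i := ⟨he, hm⟩
  have hmp : IsMonHom p := ⟨rfl, by
    rw [← cancel_mono i, Category.assoc, Category.assoc, hpi, IsMonHom.mul_hom φ,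
      IsMonHom.mul_hom i, tensorHom_comp_tensorHom_assoc, hpi]⟩
  refine ⟨CommGrp.mk Y, InducedCategory.homMk (Grp.homMk (A := ⟨A.X⟩) (B := ⟨Y⟩) p),
    InducedCategory.homMk (Grp.homMk (A := ⟨Y⟩) (B := ⟨B.X⟩) i), ⟨hYp, hYi⟩, hi, ?_, ?_⟩
  · exact inferInstanceAs (IsDominant p.left)
  · exact CommGrp.hom_ext _ _ hpi

/-- The endomorphism ring of a simple abelian variety has no zero divisors. -/
theorem IsSimpleAbelianVariety.eq_zero_or_eq_zero {B : GrpSch K} (hB : IsSimpleAbelianVariety B)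
    (f g : B ⟶ B) (h : f ≫ g = 0) : f = 0 ∨ g = 0 := by
  have := hB.1
  obtain ⟨Y, p, i, hY, hi, hp, rfl⟩ := exists_image f
  -- The image of f is 0 or B. In the second case g vanishes after a dominant morphism, hence is 0.
  rcases hB.2.2 Y i hY hi with h0 | hi'
  · left
    rw [h0.eq_of_src i 0, comp_zero]
  · right
    have hz : i ≫ g = 0 := by
      refine eq_of_isDominant_comp_eq p.hom.hom.hom.left _ _ ?_
      have : p ≫ i ≫ g = p ≫ 0 := by rw [← Category.assoc, h, comp_zero]
      exact congrArg (fun t => t.hom.hom.hom.left) this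
    rw [← cancel_epi i, hz, comp_zero]

end Simple

/-! ### Endomorphism algebras after tensoring with ℚ. -/

section Rational

variable {M : Type u} [AddCommGroup M]

lemma exists_smul_eq_one_tmul (x : ℚ ⊗[ℤ] M) :
    ∃ (n : ℤ) (m : M), n ≠ 0 ∧ n • x = 1 ⊗ₜ m := by
  induction x with
  | zero => exact ⟨1, 0, one_ne_zero, by simp⟩
  | add x y hx hy =>
    obtain ⟨a, m, ha, hm⟩ := hx
    obtain ⟨b, n, hb, hn⟩ := hy
    refine ⟨a * b, b • m + a • n, mul_ne_zero ha hb, ?_⟩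
    rw [smul_add, mul_comm, mul_smul, hm, mul_comm, mul_smul, hn, TensorProduct.tmul_add,
      TensorProduct.tmul_smul, TensorProduct.tmul_smul]
  | tmul q m =>
    refine ⟨q.den, q.num • m, by simp, ?_⟩
    rw [TensorProduct.tmul_smul, TensorProduct.smul_tmul', TensorProduct.smul_tmul']
    congr 1
    rw [zsmul_eq_mul, zsmul_eq_mul, mul_one, Int.cast_natCast, mul_comm, Rat.mul_den_eq_num]

lemma exists_smul_eq_zero_of_one_tmul_eq_zero (m : M) (h : (1 : ℚ) ⊗ₜ[ℤ] m = 0) :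
    ∃ n : ℤ, n ≠ 0 ∧ n • m = 0 := by
  have := (IsLocalizedModule.eq_zero_iff (nonZeroDivisors ℤ) (TensorProduct.mk ℤ ℚ M 1)
    (m := m)).1 h
  obtain ⟨n, hn⟩ := this
  exact ⟨n, nonZeroDivisors.ne_zero n.2, hn⟩

lemma eq_zero_of_zsmul_eq_zero (x : ℚ ⊗[ℤ] M) (n : ℤ) (hn : n ≠ 0) (h : n • x = 0) : x = 0 := by
  have h' : (n : ℚ) • x = 0 := by rw [Int.cast_smul_eq_zsmul, h]
  exact (smul_eq_zero_iff_right (by exact_mod_cast hn)).1 h'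

end Rational

section IsogEnd

variable {C : Type u} [Category.{v} C] [Preadditive C]

/-- Clearing denominators turns a zero product in ℚ ⊗ End into an integral product that is torsion.
-/
lemma Isog.noZeroDivisors_end (X : C) (h : ∀ f g : X ⟶ X, f ≫ g = 0 → f = 0 ∨ g = 0) :
    NoZeroDivisors (End (⟨X⟩ : Isog C)) := by
  refine ⟨fun {x y} hxy => ?_⟩
  change ℚ ⊗[ℤ] (X ⟶ X) at x
  change ℚ ⊗[ℤ] (X ⟶ X) at y
  change comp₂ X X X y x = 0 at hxy
  change x = 0 ∨ y = 0
  obtain ⟨a, f, ha, hf⟩ := exists_smul_eq_one_tmul x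
  obtain ⟨b, g, hb, hg⟩ := exists_smul_eq_one_tmul y
  have h₁ : (1 : ℚ) ⊗ₜ[ℤ] (g ≫ f) = 0 := by
    have : comp₂ X X X (b • y) (a • x) = 0 := by simp [hxy]
    rw [hf, hg, comp₂_tmul, one_mul] at this
    exact this
  obtain ⟨n, hn, h₂⟩ := exists_smul_eq_zero_of_one_tmul_eq_zero _ h₁
  -- The torsion multiplier n is absorbed into one factor, giving a product that is exactly zero.
  rw [← Preadditive.zsmul_comp] at h₂
  rcases h _ _ h₂ with h₃ | h₃
  · right
    refine eq_zero_of_zsmul_eq_zero y (n * b) (mul_ne_zero hn hb) ?_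
    rw [mul_smul, hg, ← TensorProduct.tmul_smul, h₃, TensorProduct.tmul_zero]
  · left
    refine eq_zero_of_zsmul_eq_zero x a ha ?_
    rw [hf, h₃, TensorProduct.tmul_zero]

lemma Isog.commute_end (X : C) (h : ∀ f g : X ⟶ X, f ≫ g = g ≫ f)
    (x y : End (⟨X⟩ : Isog C)) : x * y = y * x := by
  change ℚ ⊗[ℤ] (X ⟶ X) at x
  change ℚ ⊗[ℤ] (X ⟶ X) at y
  change comp₂ X X X y x = comp₂ X X X x y
  induction x with
  | zero => simp
  | add x x' hx hx' => rw [map_add, map_add, LinearMap.add_apply, hx, hx']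
  | tmul a f =>
    induction y with
    | zero => simp
    | add y y' hy hy' => rw [map_add, map_add, LinearMap.add_apply, hy, hy']
    | tmul b g => rw [comp₂_tmul, comp₂_tmul, h, mul_comm]

lemma Isog.charZero_end (X : C) [Nontrivial (End (⟨X⟩ : Isog C))] :
    CharZero (End (⟨X⟩ : Isog C)) := by
  refine charZero_of_inj_zero fun n hn => ?_
  by_contra h
  refine one_ne_zero (α := End (⟨X⟩ : Isog C)) ?_
  refine eq_zero_of_zsmul_eq_zero (M := (X ⟶ X)) (1 : End (⟨X⟩ : Isog C)) n
    (by exact_mod_cast h) ?_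
  have : (n : ℤ) • (1 : End (⟨X⟩ : Isog C)) = 0 := by
    rw [zsmul_eq_mul, mul_one, Int.cast_natCast, hn]
  exact this

end IsogEnd

/-! ### Multiplicative maps from matrices to the center. -/

section Algebra

/-- A matrix ring of size at least two has nonzero nilpotents, such as an off-diagonal matrix unit.
-/
lemma ringEquiv_of_matrix_of_noZeroDivisors {A D : Type*} [Ring A] [NoZeroDivisors A]
    [DivisionRing D] {m : ℕ} (hm : 0 < m) (e : A ≃+* Matrix (Fin m) (Fin m) D) :
    Nonempty (A ≃+* D) := by
  obtain rfl | ⟨m, rfl⟩ : m = 1 ∨ ∃ l, m = l + 2 := by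
    rcases m with _ | _ | m
    · omega
    · exact Or.inl rfl
    · exact Or.inr ⟨m, rfl⟩
  · exact ⟨e.trans Matrix.uniqueRingEquiv⟩
  · exfalso
    let a : Matrix (Fin (m + 2)) (Fin (m + 2)) D := Matrix.single 0 1 1
    have h : e.symm a * e.symm a = 0 := by
      rw [← map_mul, Matrix.single_mul_single_of_ne _ _ _ _ (by simp), map_zero]
    have h' : a = 0 := by simpa using mul_self_eq_zero.1 h
    have := congrFun (congrFun h' 0) 1
    simp [a] at this

/-- The reduced norm of a matrix algebra over an algebra isomorphic to a division algebra of
dimension `t²` over its center. -/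
lemma exists_matrix_reducedNorm {A D : Type u} [Ring A] [CharZero A] [DivisionRing D]
    (e : A ≃+* D) [Module.Finite (Subring.center D) D] {t n : ℕ} (hn : n ≠ 0)
    (ht : Module.finrank (Subring.center D) D = t ^ 2) :
    ∃ χ : Matrix (Fin n) (Fin n) A →* Subring.center A,
      ∀ r : Subring.center A, χ (Matrix.scalar (Fin n) (r : A)) = r ^ (n * t) := by
  have := Fin.pos_iff_nonempty.1 (Nat.pos_of_ne_zero hn)
  have hD : CharZero D := charZero_of_injective_ringHom (f := (e : A →+* D)) e.injective
  have hcent : Algebra.IsCentral (Subring.center D) D := by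
    refine ⟨fun x hx => Algebra.mem_bot.2 ⟨⟨x, ?_⟩, rfl⟩⟩
    exact Subring.mem_center_iff.2 fun y => (Subalgebra.mem_center_iff.1 hx y)
  obtain ⟨N, hN⟩ := exists_reducedNorm (Subring.center D) (Matrix (Fin n) (Fin n) D) (n * t)
    (by rw [Module.finrank_matrix, ht]; simp; ring)
  let ec : Subring.center A ≃+* Subring.center D := Subring.centerCongr e
  refine ⟨(ec.symm : Subring.center D ≃* Subring.center A).toMonoidHom.comp
    (N.comp (e.mapMatrix (m := Fin n)).toRingHom.toMonoidHom), fun r => ?_⟩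
  have : e.mapMatrix (Matrix.scalar (Fin n) (r : A)) =
      algebraMap (Subring.center D) (Matrix (Fin n) (Fin n) D) (ec r) := by
    ext i j
    have he : e r = algebraMap (Subring.center D) D (ec r) := rfl
    simp only [Matrix.scalar_apply, RingEquiv.mapMatrix_apply, Matrix.map_apply,
      Matrix.diagonal_apply, Matrix.algebraMap_matrix_apply]
    split_ifs <;> simp [he]
  change ec.symm (N (e.mapMatrix _)) = _
  rw [this, hN, map_pow, ec.symm_apply_apply]

/-- In the commutative case the center is the whole ring, and the determinant serves. -/
lemma exists_matrix_det {A : Type u} [Ring A] (h : ∀ x y : A, x * y = y * x) (n : ℕ) :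
    ∃ χ : Matrix (Fin n) (Fin n) A →* Subring.center A,
      ∀ r : Subring.center A, χ (Matrix.scalar (Fin n) (r : A)) = r ^ n := by
  let f : A →+* Subring.center A :=
    (RingHom.id A).codRestrict (Subring.center A) fun x => Subring.mem_center_iff.2 fun y => h y x
  refine ⟨Matrix.detMonoidHom.comp (f.mapMatrix (m := Fin n)).toMonoidHom, fun r => ?_⟩
  change (f.mapMatrix (Matrix.scalar (Fin n) (r : A))).det = r ^ n
  have : f.mapMatrix (Matrix.scalar (Fin n) (r : A)) = Matrix.scalar (Fin n) r := by
    have hf : f r = r := rfl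
    ext i j
    simp only [Matrix.scalar_apply, RingHom.mapMatrix_apply, Matrix.map_apply,
      Matrix.diagonal_apply]
    split_ifs <;> simp [hf]
  rw [this]
  simp

end Algebra

/-! ### The two power statements, for simple varieties and for commutative endomorphism rings. -/

section Main

variable {k Ω : Type u} [Field k] [Field Ω] [Algebra k Ω] [Algebra.IsAlgebraic k Ω]

theorem CompatibleSystem.cohomologyClass_pow_eq_one_of_isSimple {B : GrpSch Ω}
    (hB : IsSimpleAbelianVariety B) {t : ℕ} (ht : HasSchurIndex (End0 B) t) {n : ℕ}
    (hn : HasModelUpToIsogeny k (power B n)) (μ : CompatibleSystem k B) :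
    μ.cohomologyClass ^ (n * t) = 1 := by
  -- For n = 0 the exponent is 0; the case is split off because the zero matrix ring is not simple
  -- and has no reduced norm argument.
  rcases eq_or_ne n 0 with rfl | hn0
  · rw [zero_mul, pow_zero]
  obtain ⟨D, _, m, hm, ⟨e⟩, hfin, hrank⟩ := ht
  have := Isog.noZeroDivisors_end B hB.eq_zero_or_eq_zero
  obtain ⟨e'⟩ := ringEquiv_of_matrix_of_noZeroDivisors hm e
  have : Nontrivial (End0 B) := e'.nontrivial
  have := Isog.charZero_end B
  obtain ⟨χ, hχ⟩ := exists_matrix_reducedNorm e' hn0 hrank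
  obtain ⟨M, hM, hu, hmul⟩ := μ.exists_matrix hn
  exact μ.cohomologyClass_pow_eq_one M hM hu hmul χ hχ

theorem CompatibleSystem.cohomologyClass_pow_eq_one_of_comm {B : GrpSch Ω}
    (hB : ∀ f g : B ⟶ B, f ≫ g = g ≫ f) {n : ℕ}
    (hn : HasModelUpToIsogeny k (power B n)) (μ : CompatibleSystem k B) :
    μ.cohomologyClass ^ n = 1 := by
  obtain ⟨χ, hχ⟩ := exists_matrix_det (Isog.commute_end B hB) n
  obtain ⟨M, hM, hu, hmul⟩ := μ.exists_matrix hn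
  exact μ.cohomologyClass_pow_eq_one M hM hu hmul χ hχ

end Main

/-! ### Endomorphisms of a local algebra determined by tangent vectors. -/

section LocalAlgebra

variable {K O : Type*} [Field K] [CommRing O] [Algebra K O]

/-- This admits square-zero extensions of K as test rings for the local ring at the identity. -/
instance isLocalRing_trivSqZeroExt (V : Type*) [AddCommGroup V] [Module K V] [Module Kᵐᵒᵖ V]
    [IsCentralScalar K V] : IsLocalRing (TrivSqZeroExt K V) := by
  refine IsLocalRing.of_isUnit_or_isUnit_one_sub_self fun a => ?_
  rw [TrivSqZeroExt.isUnit_iff_isUnit_fst, TrivSqZeroExt.isUnit_iff_isUnit_fst]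
  exact IsLocalRing.isUnit_or_isUnit_one_sub_self a.fst

/-- An element of the kernel `m` of an augmentation on which all tangent vectors vanish lies
in `m²`. -/
lemma mem_sq_ker_of_forall_dualNumber (ev : O →ₐ[K] K) {c : O} (hc : c ∈ RingHom.ker ev)
    (h : ∀ t : O →ₐ[K] TrivSqZeroExt K K, (∀ a, (t a).fst = ev a) → t c = 0) :
    c ∈ RingHom.ker ev ^ 2 := by
  by_contra hc'
  -- A linear form that vanishes on m² and on constants but not at c is a derivation at the
  -- augmentation, so it is a tangent vector detecting c.
  let W : Submodule K O := (RingHom.ker ev ^ 2).restrictScalars K ⊔ Submodule.span K {1}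
  have hW : c ∉ W := by
    intro hcW
    obtain ⟨y, hy, z, hz, rfl⟩ := Submodule.mem_sup.1 hcW
    obtain ⟨r, rfl⟩ := Submodule.mem_span_singleton.1 hz
    have hy' : ev y = 0 := Ideal.pow_le_self two_ne_zero hy
    have hr : r = 0 := by simpa [RingHom.mem_ker, hy'] using hc
    rw [hr, zero_smul, add_zero] at hc'
    exact hc' hy
  obtain ⟨l, hl, hlW⟩ := Submodule.exists_dual_map_eq_bot_of_notMem hW inferInstance
  have hlW' (w : O) (hw : w ∈ W) : l w = 0 := by
    have : l w ∈ W.map l := Submodule.mem_map_of_mem hw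
    rwa [hlW, Submodule.mem_bot] at this
  have hl1 : l 1 = 0 := hlW' 1 (Submodule.mem_sup_right (Submodule.mem_span_singleton_self 1))
  have hmul (a b : O) : l (a * b) = ev a * l b + ev b * l a := by
    have h₁ : (a - algebraMap K O (ev a)) * (b - algebraMap K O (ev b)) ∈ RingHom.ker ev ^ 2 := by
      rw [pow_two]
      exact Ideal.mul_mem_mul (by simp [RingHom.mem_ker]) (by simp [RingHom.mem_ker])
    have h₂ := hlW' _ (Submodule.mem_sup_left h₁)
    have h₃ : (a - algebraMap K O (ev a)) * (b - algebraMap K O (ev b)) =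
        a * b - ev a • b - ev b • a + (ev a * ev b) • 1 := by
      simp only [Algebra.smul_def, map_mul]
      ring
    rw [h₃] at h₂
    simp only [map_add, map_sub, map_smul, hl1, smul_eq_mul, mul_zero, add_zero] at h₂
    linear_combination h₂
  let t : O →ₐ[K] TrivSqZeroExt K K := AlgHom.ofLinearMap
    ((TrivSqZeroExt.inlAlgHom K K K).toLinearMap ∘ₗ ev.toLinearMap +
      TrivSqZeroExt.inrHom K K ∘ₗ l)
    (by
      ext <;> simp [hl1])
    (fun a b => by
      ext
      · simp
      · simp [hmul, mul_comm])
  have ht := h t (fun a => by simp [t])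
  apply hl
  have := congrArg TrivSqZeroExt.snd ht
  simpa [t] using this

/-- Multiplication by r on I/I² induces multiplication by r^(n+1) on I^(n+1)/I^(n+2), since that
quotient is spanned by products of n+1 elements of I. -/
lemma map_sub_pow_mul_mem_pow {R : Type*} [CommRing R] {I : Ideal R} (T : R →+* R) (r : R)
    (hT : ∀ a ∈ I, T a - r * a ∈ I ^ 2) (n : ℕ) :
    ∀ a ∈ I ^ (n + 1), T a - r ^ (n + 1) * a ∈ I ^ (n + 2) := by
  have hTI (a : R) (ha : a ∈ I) : T a ∈ I := by
    have := I.add_mem (Ideal.pow_le_self two_ne_zero (hT a ha)) (I.mul_mem_left r ha)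
    rwa [sub_add_cancel] at this
  induction n with
  | zero => simpa using hT
  | succ n ih =>
    intro a ha
    rw [pow_succ] at ha
    refine Submodule.mul_induction_on ha (fun x hx y hy => ?_) (fun x y hx hy => ?_)
    · have h₁ : (T x - r ^ (n + 1) * x) * T y ∈ I ^ (n + 2 + 1) := by
        rw [pow_succ]
        exact Ideal.mul_mem_mul (ih x hx) (hTI y hy)
      have h₂ : r ^ (n + 1) * (x * (T y - r * y)) ∈ I ^ (n + 1 + 2) := by
        rw [pow_add]
        exact Ideal.mul_mem_left _ _ (Ideal.mul_mem_mul hx (hT y hy))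
      convert (I ^ (n + 3)).add_mem h₁ h₂ using 1
      rw [map_mul]
      ring
    · convert (I ^ (n + 1 + 2)).add_mem hx hy using 1
      rw [map_add]
      ring

/-- An endomorphism of a Noetherian local algebra that is trivial on tangent vectors and commutes
with an endomorphism acting on them as multiplication by two is trivial. -/
lemma map_eq_zero_of_commute_two [CharZero K] [IsNoetherianRing O] [IsLocalRing O]
    (ev : O →ₐ[K] K) (H T : O →ₐ[K] O) (hHT : ∀ a, H (T a) = T (H a))
    (hH : ∀ a ∈ RingHom.ker ev, H a ∈ RingHom.ker ev ^ 2)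
    (hT : ∀ a ∈ RingHom.ker ev, T a - 2 * a ∈ RingHom.ker ev ^ 2) :
    ∀ a ∈ RingHom.ker ev, H a = 0 := by
  set I : Ideal O := RingHom.ker ev with hI
  have key (n : ℕ) : ∀ a ∈ I, H a ∈ I ^ (n + 2) := by
    induction n with
    | zero => simpa using hH
    | succ n ih =>
      intro a ha
      have hmap : I.map (H : O →+* O) ≤ I ^ (n + 2) := Ideal.map_le_iff_le_comap.2 ih
      -- As T a - 2a lies in I², its image under H lies in the square of I^(n+2), which is deep
      -- enough.
      have h₁ : H (T a) - 2 * H a ∈ I ^ (n + 3) := by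
        have h := Ideal.mem_map_of_mem (H : O →+* O) (hT a ha)
        rw [Ideal.map_pow] at h
        have h' := (Ideal.pow_right_mono hmap 2) h
        rw [← pow_mul] at h'
        have := Ideal.pow_le_pow_right (I := I) (show n + 3 ≤ (n + 2) * 2 by omega) h'
        simpa [map_ofNat] using this
      -- On the other hand H a lies in I^(n+2), where T acts as 2^(n+2) modulo I^(n+3). As H and T
      -- commute, the two scalars can be compared.
      have h₂ := map_sub_pow_mul_mem_pow (T : O →+* O) 2 hT (n + 1) (H a) (ih a ha)
      have h₃ : ((2 : K) ^ (n + 2) - 2) • H a ∈ I ^ (n + 3) := by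
        have := (I ^ (n + 3)).sub_mem h₁ h₂
        rw [hHT] at this
        convert this using 1
        rw [Algebra.smul_def, map_sub, map_pow, map_ofNat, AlgHom.coe_toRingHom]
        ring
      -- The exponent is at least two because H starts in I²; at exponent one the two scalars would
      -- coincide.
      have h₄ : (2 : K) ^ (n + 2) - 2 ≠ 0 := by
        have : (2 : K) ^ (n + 2) - 2 = ((2 ^ (n + 2) - 2 : ℤ) : K) := by push_cast; ring
        rw [this, Int.cast_ne_zero]
        have : (2 : ℤ) ^ n ≥ 1 := one_le_pow₀ (by norm_num)
        rw [pow_add]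
        omega
      have := Submodule.smul_of_tower_mem (I ^ (n + 3)) ((2 : K) ^ (n + 2) - 2)⁻¹ h₃
      rwa [inv_smul_smul₀ h₄] at this
  intro a ha
  -- Krull's intersection theorem ends the argument.
  have hbot := Ideal.iInf_pow_eq_bot_of_isLocalRing I (RingHom.ker_ne_top _)
  rw [← Ideal.mem_bot, ← hbot, Ideal.mem_iInf]
  exact fun n => Ideal.pow_le_pow_right (by omega) (key n a ha)

end LocalAlgebra

/-! ### Points of a group scheme near the identity. -/

section SpecOver

variable (K : Type u) [Field K]

/-- The spectrum of a `K`-algebra, as a scheme over `K`. -/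
def specOver (R : Type u) [CommRing R] [Algebra K R] : Over (Spec (CommRingCat.of K)) :=
  Over.mk (Spec.map (CommRingCat.ofHom (algebraMap K R)))

variable {K}
variable {R S T : Type u} [CommRing R] [Algebra K R] [CommRing S] [Algebra K S] [CommRing T]
  [Algebra K T]

/-- The morphism of spectra given by a homomorphism of `K`-algebras. -/
def specOverMap (φ : R →ₐ[K] S) : specOver K S ⟶ specOver K R :=
  Over.homMk (Spec.map (CommRingCat.ofHom φ.toRingHom)) (by
    change Spec.map _ ≫ Spec.map _ = Spec.map _
    rw [← Spec.map_comp, ← CommRingCat.ofHom_comp]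
    congr 2
    exact φ.comp_algebraMap)

lemma specOverMap_id : specOverMap (AlgHom.id K R) = 𝟙 (specOver K R) :=
  Over.OverMorphism.ext (Spec.map_id _)

lemma specOverMap_comp (φ : R →ₐ[K] S) (ψ : S →ₐ[K] T) :
    specOverMap (ψ.comp φ) = specOverMap ψ ≫ specOverMap φ :=
  Over.OverMorphism.ext (Spec.map_comp (CommRingCat.ofHom φ.toRingHom)
    (CommRingCat.ofHom ψ.toRingHom))

lemma specOverMap_comp_assoc (φ : R →ₐ[K] S) (ψ : S →ₐ[K] T) {X : Over (Spec (CommRingCat.of K))}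
    (u : specOver K R ⟶ X) :
    specOverMap ψ ≫ specOverMap φ ≫ u = specOverMap (ψ.comp φ) ≫ u := by
  rw [specOverMap_comp, Category.assoc]

lemma specOverMap_map_comp_assoc {U V W : Type u} [AddCommGroup U] [Module K U] [Module Kᵐᵒᵖ U]
    [IsCentralScalar K U] [AddCommGroup V] [Module K V] [Module Kᵐᵒᵖ V] [IsCentralScalar K V]
    [AddCommGroup W] [Module K W] [Module Kᵐᵒᵖ W] [IsCentralScalar K W] (f : U →ₗ[K] V)
    (g : V →ₗ[K] W) {X : Over (Spec (CommRingCat.of K))}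
    (u : specOver K (TrivSqZeroExt K U) ⟶ X) :
    specOverMap (TrivSqZeroExt.map g) ≫ specOverMap (TrivSqZeroExt.map f) ≫ u =
      specOverMap (TrivSqZeroExt.map (g ∘ₗ f)) ≫ u := by
  rw [specOverMap_comp_assoc, TrivSqZeroExt.map_comp_map]

lemma specOverMap_injective : Function.Injective (specOverMap : (R →ₐ[K] S) → _) := by
  intro φ ψ h
  have h₁ : Spec.map (CommRingCat.ofHom φ.toRingHom) = Spec.map (CommRingCat.ofHom ψ.toRingHom) :=
    congrArg CommaMorphism.left h
  have h₂ := Spec.map_injective h₁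
  ext x
  exact DFunLike.congr_fun (congrArg CommRingCat.Hom.hom h₂) x

end SpecOver

section FormalPoint

open scoped MonObj
open TrivSqZeroExt (fstHom inlAlgHom)

variable {K : Type u} [Field K]

/-- `j` is the inclusion of the spectrum of the local ring at the identity of the group `G`. -/
structure IsLocalAtOne (G : Over (Spec (CommRingCat.of K))) [GrpObj G] {O : Type u} [CommRing O]
    [Algebra K O] (ev : O →ₐ[K] K) (j : specOver K O ⟶ G) : Prop where
  mono : Mono j
  ev_comp : specOverMap ev ≫ j = 1
  exists_lift {R : Type u} [CommRing R] [Algebra K R] [IsLocalRing R] (a : R →ₐ[K] K)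
    (w : specOver K R ⟶ G) (hw : specOverMap a ≫ w = 1) : ∃ φ : O →ₐ[K] R, specOverMap φ ≫ j = w

namespace IsLocalAtOne

variable {G : Over (Spec (CommRingCat.of K))} [GrpObj G] {O : Type u} [CommRing O]
  [Algebra K O] {ev : O →ₐ[K] K} {j : specOver K O ⟶ G}

lemma algHom_ext (hj : IsLocalAtOne G ev j) {R : Type u} [CommRing R] [Algebra K R]
    {φ ψ : O →ₐ[K] R} (h : specOverMap φ ≫ j = specOverMap ψ ≫ j) : φ = ψ := by
  have := hj.mono
  exact specOverMap_injective ((cancel_mono j).1 h)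

lemma specOverMap_fst_comp (hj : IsLocalAtOne G ev j) {V : Type u} [AddCommGroup V] [Module K V]
    [Module Kᵐᵒᵖ V] [IsCentralScalar K V] {t : O →ₐ[K] TrivSqZeroExt K V}
    (ht : ∀ a, (t a).fst = ev a) :
    specOverMap (fstHom K K V) ≫ specOverMap t ≫ j = 1 := by
  rw [specOverMap_comp_assoc, ← hj.ev_comp]
  congr 2
  ext a
  exact ht a

/-- The group law on tangent vectors is addition: the square of `t` is `2t`. -/
lemma mul_self_eq (hj : IsLocalAtOne G ev j) {t : O →ₐ[K] TrivSqZeroExt K K}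
    (ht : ∀ a, (t a).fst = ev a) :
    (specOverMap t ≫ j) * (specOverMap t ≫ j) =
      specOverMap ((TrivSqZeroExt.map ((2 : K) • LinearMap.id)).comp t) ≫ j := by
  obtain ⟨w, hw⟩ : ∃ w, w = specOverMap t ≫ j := ⟨_, rfl⟩
  rw [← hw]
  let δ : TrivSqZeroExt K K →ₐ[K] TrivSqZeroExt K (K × K) :=
    TrivSqZeroExt.map (LinearMap.id.prod LinearMap.id)
  let i₁ : TrivSqZeroExt K K →ₐ[K] TrivSqZeroExt K (K × K) :=
    TrivSqZeroExt.map (LinearMap.inl K K K)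
  let i₂ : TrivSqZeroExt K K →ₐ[K] TrivSqZeroExt K (K × K) :=
    TrivSqZeroExt.map (LinearMap.inr K K K)
  let p₁ : TrivSqZeroExt K (K × K) →ₐ[K] TrivSqZeroExt K K :=
    TrivSqZeroExt.map (LinearMap.fst K K K)
  let p₂ : TrivSqZeroExt K (K × K) →ₐ[K] TrivSqZeroExt K K :=
    TrivSqZeroExt.map (LinearMap.snd K K K)
  let Δ : TrivSqZeroExt K (K × K) →ₐ[K] TrivSqZeroExt K K :=
    TrivSqZeroExt.map (LinearMap.fst K K K + LinearMap.snd K K K)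
  have hfst := hj.specOverMap_fst_comp ht
  rw [← hw] at hfst
  have hpush (l : K →ₗ[K] K × K) :
      specOverMap (fstHom K K (K × K)) ≫ specOverMap (TrivSqZeroExt.map l) ≫ w = 1 := by
    rw [specOverMap_comp_assoc, ← hfst]
    congr 2
    ext
    simp
  have hid : specOverMap (TrivSqZeroExt.map (LinearMap.id : K →ₗ[K] K)) ≫ w = w := by
    rw [TrivSqZeroExt.map_id, specOverMap_id, Category.id_comp]
  have hzero : specOverMap (TrivSqZeroExt.map (0 : K →ₗ[K] K)) ≫ w = 1 := by
    have : TrivSqZeroExt.map (0 : K →ₗ[K] K) = (inlAlgHom K K K).comp (fstHom K K K) := by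
      ext
      all_goals simp
    rw [this, ← specOverMap_comp_assoc, hfst, MonObj.comp_one]
  -- The two factors are placed in independent infinitesimal directions, and their product is a
  -- point q over K ⊕ (K × K).
  obtain ⟨q, hq⟩ := hj.exists_lift (fstHom K K (K × K))
    ((specOverMap i₁ ≫ w) * (specOverMap i₂ ≫ w)) (by
      rw [MonObj.comp_mul, hpush, hpush, mul_one])
  have h₁ : p₁.comp q = p₁.comp (δ.comp t) := by
    apply hj.algHom_ext
    rw [← specOverMap_comp_assoc, hq, MonObj.comp_mul, specOverMap_map_comp_assoc,
      specOverMap_map_comp_assoc,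
      LinearMap.fst_comp_inl, LinearMap.fst_comp_inr, hid, hzero, mul_one,
      ← AlgHom.comp_assoc, ← TrivSqZeroExt.map_comp_map, LinearMap.fst_prod,
      ← specOverMap_comp_assoc, ← hw, hid]
  have h₂ : p₂.comp q = p₂.comp (δ.comp t) := by
    apply hj.algHom_ext
    rw [← specOverMap_comp_assoc, hq, MonObj.comp_mul, specOverMap_map_comp_assoc,
      specOverMap_map_comp_assoc,
      LinearMap.snd_comp_inl, LinearMap.snd_comp_inr, hid, hzero, one_mul,
      ← AlgHom.comp_assoc, ← TrivSqZeroExt.map_comp_map, LinearMap.snd_prod,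
      ← specOverMap_comp_assoc, ← hw, hid]
  -- Killing either direction leaves t, and a point over K ⊕ (K × K) is determined by these two
  -- restrictions.
  have h : q = δ.comp t := by
    ext a
    · simpa [p₁] using congrArg TrivSqZeroExt.fst (DFunLike.congr_fun h₁ a)
    · simpa [p₁] using congrArg TrivSqZeroExt.snd (DFunLike.congr_fun h₁ a)
    · simpa [p₂] using congrArg TrivSqZeroExt.snd (DFunLike.congr_fun h₂ a)
  -- Identifying the two directions turns the product into w · w and the pair (t, t) into 2t.
  have h₃ : specOverMap Δ ≫ specOverMap q ≫ j = w * w := by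
    rw [hq, MonObj.comp_mul, specOverMap_map_comp_assoc,
      specOverMap_map_comp_assoc,
      LinearMap.add_comp, LinearMap.add_comp, LinearMap.fst_comp_inl, LinearMap.fst_comp_inr,
      LinearMap.snd_comp_inl, LinearMap.snd_comp_inr, zero_add, add_zero, hid]
  rw [← h₃, h, specOverMap_comp_assoc, ← AlgHom.comp_assoc, ← TrivSqZeroExt.map_comp_map,
    LinearMap.add_comp, LinearMap.fst_prod, LinearMap.snd_prod, two_smul]

end IsLocalAtOne

/-- Endomorphisms commute near the identity if the tangent space has dimension at most one. -/
theorem IsLocalAtOne.comp_comm [CharZero K] {C : GrpSch K} {O : Type u} [CommRing O] [Algebra K O]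
    [IsNoetherianRing O] [IsLocalRing O] {ev : O →ₐ[K] K} {j : specOver K O ⟶ C.X}
    (hj : IsLocalAtOne C.X ev j) (t₀ : O →ₐ[K] TrivSqZeroExt K K)
    (h₀ : ∀ t : O →ₐ[K] TrivSqZeroExt K K, (∀ a, (t a).fst = ev a) →
      ∃ r : K, t = (TrivSqZeroExt.map (r • LinearMap.id)).comp t₀)
    (ht₀ : ∀ a, (t₀ a).fst = ev a)
    (f g : C ⟶ C) : j ≫ (f ≫ g).hom.hom.hom = j ≫ (g ≫ f).hom.hom.hom := by
  -- A homomorphism fixes the identity, so it acts on the local ring there.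
  have lift (f : C ⟶ C) : ∃ F : O →ₐ[K] O, specOverMap F ≫ j = j ≫ f.hom.hom.hom := by
    refine hj.exists_lift ev _ ?_
    rw [← Category.assoc, hj.ev_comp, MonObj.one_comp]
  have hev (f : C ⟶ C) (F : O →ₐ[K] O) (hF : specOverMap F ≫ j = j ≫ f.hom.hom.hom) :
      ev.comp F = ev := by
    apply hj.algHom_ext
    rw [← specOverMap_comp_assoc, hF, ← Category.assoc, hj.ev_comp, MonObj.one_comp]
  have hscale (f : C ⟶ C) : ∃ r : K, specOverMap t₀ ≫ j ≫ f.hom.hom.hom =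
      specOverMap (TrivSqZeroExt.map (r • LinearMap.id)) ≫ specOverMap t₀ ≫ j := by
    obtain ⟨F, hF⟩ := lift f
    obtain ⟨r, hr⟩ := h₀ (t₀.comp F) (fun a => by
      rw [← hev f F hF]
      exact ht₀ (F a))
    refine ⟨r, ?_⟩
    rw [← hF, specOverMap_comp_assoc, specOverMap_comp_assoc, hr]
  -- Both endomorphisms act on the tangent line by scalars, and scalars commute.
  have hcomm₀ : specOverMap t₀ ≫ j ≫ (f ≫ g).hom.hom.hom =
      specOverMap t₀ ≫ j ≫ (g ≫ f).hom.hom.hom := by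
    obtain ⟨r, hr⟩ := hscale f
    obtain ⟨s, hs⟩ := hscale g
    change specOverMap t₀ ≫ j ≫ f.hom.hom.hom ≫ g.hom.hom.hom =
      specOverMap t₀ ≫ j ≫ g.hom.hom.hom ≫ f.hom.hom.hom
    rw [reassoc_of% hr, reassoc_of% hs, hr, hs, specOverMap_map_comp_assoc,
      specOverMap_map_comp_assoc]
    congr 3
    ext
    simp [mul_comm]
  have hcomm (t : O →ₐ[K] TrivSqZeroExt K K) (ht : ∀ a, (t a).fst = ev a) :
      specOverMap t ≫ j ≫ (f ≫ g).hom.hom.hom = specOverMap t ≫ j ≫ (g ≫ f).hom.hom.hom := by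
    obtain ⟨r, rfl⟩ := h₀ t ht
    rw [specOverMap_comp, Category.assoc, hcomm₀, Category.assoc]
  -- The commutator acts as zero on tangent vectors, and commutes with doubling like every
  -- endomorphism.
  let h : C ⟶ C := f ≫ g - g ≫ f
  have hh : f ≫ g = h + g ≫ f := by simp [h]
  have hhm : (f ≫ g).hom.hom.hom = h.hom.hom.hom * (g ≫ f).hom.hom.hom := by
    rw [hh]
    exact hom_add _ _
  have htriv (t : O →ₐ[K] TrivSqZeroExt K K) (ht : ∀ a, (t a).fst = ev a) :
      specOverMap t ≫ j ≫ h.hom.hom.hom = 1 := by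
    have := hcomm t ht
    rw [hhm, MonObj.comp_mul, MonObj.comp_mul] at this
    exact mul_eq_right.1 this
  let two : C ⟶ C := 𝟙 C + 𝟙 C
  have htwo : two.hom.hom.hom = 𝟙 C.X * 𝟙 C.X := hom_add _ _
  have hht : h ≫ two = two ≫ h := by simp [two]
  obtain ⟨H, hH⟩ := lift h
  obtain ⟨T, hT⟩ := lift two
  have hHT (a : O) : H (T a) = T (H a) := by
    have : H.comp T = T.comp H := by
      apply hj.algHom_ext
      rw [← specOverMap_comp_assoc, hT, ← specOverMap_comp_assoc, hH, ← Category.assoc, hH,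
        ← Category.assoc, hT, Category.assoc, Category.assoc]
      exact congrArg (fun z : C ⟶ C => j ≫ z.hom.hom.hom) hht
    exact DFunLike.congr_fun this a
  have hH2 : ∀ a ∈ RingHom.ker ev, H a ∈ RingHom.ker ev ^ 2 := by
    intro a ha
    refine mem_sq_ker_of_forall_dualNumber ev ?_ fun t ht => ?_
    · exact (DFunLike.congr_fun (hev h H hH) a).trans ha
    · have : t.comp H = (inlAlgHom K K K).comp ev := by
        apply hj.algHom_ext
        rw [← specOverMap_comp_assoc, hH, htriv t ht, ← specOverMap_comp_assoc, hj.ev_comp,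
          MonObj.comp_one]
      have h' := DFunLike.congr_fun this a
      have ha' : ev a = 0 := ha
      simpa [ha'] using h'
  have hT2 : ∀ a ∈ RingHom.ker ev, T a - 2 * a ∈ RingHom.ker ev ^ 2 := by
    intro a ha
    have ha' : ev a = 0 := ha
    refine mem_sq_ker_of_forall_dualNumber ev ?_ fun t ht => ?_
    · have := (DFunLike.congr_fun (hev two T hT) a).trans ha'
      change ev (T a) = 0 at this
      rw [RingHom.mem_ker, map_sub, map_mul, this, ha', mul_zero, sub_zero]
    · have : t.comp T = (TrivSqZeroExt.map ((2 : K) • LinearMap.id)).comp t := by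
        apply hj.algHom_ext
        rw [← hj.mul_self_eq ht, ← specOverMap_comp_assoc, hT, htwo, MonObj.comp_mul,
          MonObj.comp_mul, Category.comp_id]
      have h' : t (T a) = TrivSqZeroExt.map ((2 : K) • LinearMap.id) (t a) :=
        DFunLike.congr_fun this a
      have h₂ : (t a).fst = 0 := (ht a).trans ha'
      rw [map_sub, map_mul, h', map_ofNat, sub_eq_zero]
      ext
      · simp [h₂]
      · rw [two_mul]
        simp [two_mul]
  have hH0 := map_eq_zero_of_commute_two ev H T hHT hH2 hT2
  -- H kills the maximal ideal, so it is evaluation at the identity; geometrically, h is constant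
  -- near the identity.
  have hHev : H = (Algebra.ofId K O).comp ev := by
    ext a
    have := hH0 (a - algebraMap K O (ev a)) (by simp [RingHom.mem_ker])
    rw [map_sub, AlgHom.commutes, sub_eq_zero] at this
    exact this
  have hj1 : j ≫ h.hom.hom.hom = 1 := by
    rw [← hH, hHev, ← specOverMap_comp_assoc, hj.ev_comp, MonObj.comp_one]
  rw [hhm, MonObj.comp_mul, hj1, one_mul]

end FormalPoint

/-! ### The local ring at the identity. -/

section LocalRing

open scoped MonObj

lemma exists_specMap_fromSpecStalk_eq {X : Scheme.{u}} {R : Type u} [CommRing R] [IsLocalRing R]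
    (w : Spec (CommRingCat.of R) ⟶ X) (x : X) (hx : w (IsLocalRing.closedPoint R) = x) :
    ∃ φ : X.presheaf.stalk x ⟶ CommRingCat.of R, Spec.map φ ≫ X.fromSpecStalk x = w := by
  subst hx
  have : IsLocalRing (CommRingCat.of R) := ‹_›
  exact ⟨Scheme.stalkClosedPointTo w, Scheme.Spec_stalkClosedPointTo_fromSpecStalk w⟩

lemma specMap_comp_closedPoint {X : Scheme.{u}} {R S : Type u} [CommRing R] [IsLocalRing R]
    [CommRing S] [IsLocalRing S] (a : R →+* S) [IsLocalHom a] (w : Spec (CommRingCat.of R) ⟶ X) :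
    (Spec.map (CommRingCat.ofHom a) ≫ w) (IsLocalRing.closedPoint S) =
      w (IsLocalRing.closedPoint R) :=
  (Scheme.Hom.comp_apply _ _ _).trans (congrArg w (IsLocalRing.comap_closedPoint a))

lemma specMap_appLE_germ_fromSpec {X S : Scheme.{u}} (f : X ⟶ S) {U : S.Opens} {V : X.Opens}
    (hU : IsAffineOpen U) (hV : IsAffineOpen V) (e : V ≤ f ⁻¹ᵁ U) {x : X} (hx : x ∈ V)
    {R : CommRingCat.{u}} (t : X.presheaf.stalk x ⟶ R) :
    Spec.map (f.appLE U V e ≫ X.presheaf.germ V x hx ≫ t) ≫ hU.fromSpec =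
      (Spec.map t ≫ X.fromSpecStalk x) ≫ f := by
  rw [Spec.map_comp, Spec.map_comp, Category.assoc, Category.assoc,
    IsAffineOpen.SpecMap_appLE_fromSpec _ hU hV, ← hV.fromSpecStalk_eq_fromSpecStalk hx,
    Category.assoc, IsAffineOpen.fromSpecStalk, Category.assoc]

/-- A stalk is a localization of the sections on an affine neighbourhood, so its homomorphisms are
tested on germs from there. -/
lemma hom_eq_of_germ_comp_eq {X : Scheme.{u}} {V : X.Opens}
    (hV : IsAffineOpen V) {x : X} (hx : x ∈ V) {R : CommRingCat.{u}}
    (t t' : X.presheaf.stalk x ⟶ R)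
    (h : X.presheaf.germ V x hx ≫ t = X.presheaf.germ V x hx ≫ t') : t = t' := by
  apply Spec.map_injective
  rw [← cancel_mono (X.fromSpecStalk x), ← hV.fromSpecStalk_eq_fromSpecStalk hx,
    IsAffineOpen.fromSpecStalk, ← Spec.map_comp_assoc, ← Spec.map_comp_assoc, h]

/-- The spectrum of a local ring contains the generic point, so homomorphisms of an integral group
are determined near the identity. -/
instance isDominant_fromSpecStalk {X : Scheme.{u}} [IsIntegral X] (x : X) :
    IsDominant (X.fromSpecStalk x) := by
  refine ⟨?_⟩
  have h : genericPoint X ∈ Set.range (X.fromSpecStalk x) := by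
    rw [Scheme.range_fromSpecStalk]
    exact genericPoint_specializes x
  rw [DenseRange, dense_iff_closure_eq, ← Set.univ_subset_iff, ← genericPoint_closure X]
  exact closure_mono (Set.singleton_subset_iff.2 h)

variable {K : Type u} [Field K]

/-- The point x is the image of the unit section. A morphism from a local spectrum whose closed
point goes to x factors through the stalk at x. -/
theorem exists_isLocalAtOne (G : Over (Spec (CommRingCat.of K))) [GrpObj G] :
    ∃ (x : G.left) (_ : Algebra K (G.left.presheaf.stalk x))
      (ev : G.left.presheaf.stalk x →ₐ[K] K) (j : specOver K (G.left.presheaf.stalk x) ⟶ G),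
      IsLocalAtOne G ev j ∧ j.left = G.left.fromSpecStalk x := by
  let e : specOver K K ⟶ G := 1
  let e' : Spec (CommRingCat.of K) ⟶ G.left := e.left
  let x : G.left := e' (IsLocalRing.closedPoint K)
  let κ : CommRingCat.of K ⟶ G.left.presheaf.stalk x :=
    Spec.preimage (G.left.fromSpecStalk x ≫ G.hom)
  have hκ : Spec.map κ = G.left.fromSpecStalk x ≫ G.hom := Spec.map_preimage _
  let _ : Algebra K (G.left.presheaf.stalk x) := κ.hom.toAlgebra
  let j : specOver K (G.left.presheaf.stalk x) ⟶ G := Over.homMk (G.left.fromSpecStalk x) hκ.symm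
  have hlift {R : Type u} [CommRing R] [Algebra K R] [IsLocalRing R] (w : specOver K R ⟶ G)
      (hw : (show Spec (CommRingCat.of R) ⟶ G.left from w.left) (IsLocalRing.closedPoint R) = x) :
      ∃ φ : G.left.presheaf.stalk x →ₐ[K] R, specOverMap φ ≫ j = w := by
    obtain ⟨φ, hφ⟩ := exists_specMap_fromSpecStalk_eq _ x hw
    have hκφ : κ ≫ φ = CommRingCat.ofHom (algebraMap K R) := by
      apply Spec.map_injective
      rw [Spec.map_comp, hκ, reassoc_of% hφ]
      exact Over.w w
    refine ⟨{ φ.hom with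
      commutes' := fun r => DFunLike.congr_fun (congrArg CommRingCat.Hom.hom hκφ) r }, ?_⟩
    exact Over.OverMorphism.ext hφ
  obtain ⟨ev, hev⟩ := hlift e rfl
  refine ⟨x, inferInstance, ev, j, ⟨?_, hev, fun {R} _ _ _ a w hw => hlift w ?_⟩, rfl⟩
  · have : Mono j.left := inferInstanceAs (Mono (G.left.fromSpecStalk x))
    exact Over.mono_of_mono_left j
  · have hloc : IsLocalHom a.toRingHom := by
      have hs : Function.Surjective a.toRingHom := fun r => ⟨algebraMap K R r, a.commutes r⟩
      exact IsLocalHom.of_surjective a.toRingHom hs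
    exact (specMap_comp_closedPoint a.toRingHom w.left).symm.trans
      (congrArg (fun z : specOver K K ⟶ G =>
        (show Spec (CommRingCat.of K) ⟶ G.left from z.left) (IsLocalRing.closedPoint K)) hw)

end LocalRing

/-! ### Tangent line of a smooth curve and commutativity of endomorphisms. -/

section TangentSpace

open KaehlerDifferential in
-- A tangent vector killing B is a B-derivation A → K, hence a linear form on the differentials.
-- These are free of rank one, so it is determined by its value r on a generator; c(a) is the
-- coefficient of da, evaluated by ε.
lemma exists_forall_snd_eq_mul {B A K : Type*} [CommRing B] [CommRing A] [Nontrivial A]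
    [Algebra B A] [Algebra.IsStandardSmoothOfRelativeDimension 1 B A] [Field K] (ε : A →+* K) :
    ∃ c : A → K, ∀ τ : A →+* TrivSqZeroExt K K, (∀ a, (τ a).fst = ε a) →
      (∀ b, (τ (algebraMap B A b)).snd = 0) → ∃ r, ∀ a, (τ a).snd = r * c a := by
  have : Algebra.IsStandardSmooth B A :=
    Algebra.IsStandardSmoothOfRelativeDimension.isStandardSmooth 1
  have hrank : Module.finrank A Ω[A⁄B] = 1 := by
    rw [Module.finrank,
      Algebra.IsStandardSmoothOfRelativeDimension.rank_kaehlerDifferential (R := B) (S := A) 1]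
    simp
  let b : Module.Basis Unit A Ω[A⁄B] := Module.basisUnique Unit hrank
  let _ : Module A K := Module.compHom K ε
  let _ : Module B K := Module.compHom K (ε.comp (algebraMap B A))
  have hsmul (a : A) (x : K) : a • x = ε a * x := rfl
  have : IsScalarTower B A K := ⟨fun r a x => by
    change ε (r • a) * x = ε (algebraMap B A r) * (ε a * x)
    rw [Algebra.smul_def, map_mul, mul_assoc]⟩
  refine ⟨fun a => ε (b.repr (D B A a) ()), fun τ hτ hB => ?_⟩
  let d : Derivation B A K :=
    { toFun a := (τ a).snd
      map_add' := by simp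
      map_smul' r a := by
        change _ = ε (algebraMap B A r) * (τ a).snd
        rw [Algebra.smul_def, map_mul]
        simp [hB, hτ]
      map_one_eq_zero' := by simp
      leibniz' a a' := by
        simp [hτ, hsmul, mul_comm] }
  refine ⟨d.liftKaehlerDifferential (b ()), fun a => ?_⟩
  have h₁ : D B A a = b.repr (D B A a) () • b () := by
    conv_lhs => rw [← b.sum_repr (D B A a)]
    simp
  have h₂ : d.liftKaehlerDifferential (D B A a) = (τ a).snd :=
    d.liftKaehlerDifferential_comp_D a
  rw [← h₂, h₁, map_smul, hsmul, mul_comm]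

/-- The tangent space at a rational point of a smooth curve has dimension at most one. -/
theorem exists_tangent_generator {K : Type u} [Field K] {G : Over (Spec (CommRingCat.of K))}
    [hG : SmoothOfRelativeDimension 1 G.hom] {x : G.left}
    [Algebra K (G.left.presheaf.stalk x)] {ev : G.left.presheaf.stalk x →ₐ[K] K}
    {j : specOver K (G.left.presheaf.stalk x) ⟶ G}
    (hjx : j.left = G.left.fromSpecStalk x) :
    ∃ t₀ : G.left.presheaf.stalk x →ₐ[K] TrivSqZeroExt K K, (∀ a, (t₀ a).fst = ev a) ∧
      ∀ t : G.left.presheaf.stalk x →ₐ[K] TrivSqZeroExt K K, (∀ a, (t a).fst = ev a) →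
        ∃ r : K, t = (TrivSqZeroExt.map (r • LinearMap.id)).comp t₀ := by
  obtain ⟨U, hU, V, hV, hxV, hVU, hsm⟩ := hG.exists_isStandardSmoothOfRelativeDimension x
  let γ := G.left.presheaf.germ V x hxV
  let t₁ : G.left.presheaf.stalk x →ₐ[K] TrivSqZeroExt K K :=
    (TrivSqZeroExt.inlAlgHom K K K).comp ev
  have ht₁ (a) : (t₁ a).fst = ev a := by simp [t₁]
  have hmap (t : G.left.presheaf.stalk x →ₐ[K] TrivSqZeroExt K K) :
      Spec.map (G.hom.appLE U V hVU ≫ γ ≫ CommRingCat.ofHom t.toRingHom) ≫ hU.fromSpec =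
        Spec.map (CommRingCat.ofHom (algebraMap K (TrivSqZeroExt K K))) := by
    refine (specMap_appLE_germ_fromSpec G.hom hU hV hVU hxV _).trans ?_
    rw [← hjx]
    exact Over.w (specOverMap t ≫ j)
  -- The base ring of the smooth chart consists of sections on an open part of Spec K. All tangent
  -- vectors induce the same map from it as the zero vector t₁, because they are all morphisms over
  -- K.
  have hbase (t : G.left.presheaf.stalk x →ₐ[K] TrivSqZeroExt K K)
      (b : Γ(Spec (CommRingCat.of K), U)) :
      (t (γ.hom ((G.hom.appLE U V hVU).hom b))).snd = 0 := by
    have h₁ := (cancel_mono hU.fromSpec).1 ((hmap t).trans (hmap t₁).symm)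
    have h₂ : t (γ.hom ((G.hom.appLE U V hVU).hom b)) =
        t₁ (γ.hom ((G.hom.appLE U V hVU).hom b)) :=
      DFunLike.congr_fun (congrArg CommRingCat.Hom.hom (Spec.map_injective h₁)) b
    rw [h₂]
    simp [t₁]
  have hext (t t' : G.left.presheaf.stalk x →ₐ[K] TrivSqZeroExt K K)
      (h : ∀ a, t (γ.hom a) = t' (γ.hom a)) : t = t' := by
    have := hom_eq_of_germ_comp_eq hV hxV (CommRingCat.ofHom t.toRingHom)
      (CommRingCat.ofHom t'.toRingHom) (CommRingCat.hom_ext (RingHom.ext h))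
    exact AlgHom.ext fun a => DFunLike.congr_fun (congrArg CommRingCat.Hom.hom this) a
  let _ := (G.hom.appLE U V hVU).hom.toAlgebra
  have : Algebra.IsStandardSmoothOfRelativeDimension 1 Γ(Spec (CommRingCat.of K), U) Γ(G.left, V) :=
    hsm
  have : Nontrivial Γ(G.left, V) := (ev.toRingHom.comp γ.hom).domain_nontrivial
  obtain ⟨c, hc⟩ := exists_forall_snd_eq_mul (B := Γ(Spec (CommRingCat.of K), U))
    (ev.toRingHom.comp γ.hom)
  have hc' (t : G.left.presheaf.stalk x →ₐ[K] TrivSqZeroExt K K) (ht : ∀ a, (t a).fst = ev a) :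
      ∃ r, ∀ a, (t (γ.hom a)).snd = r * c a :=
    hc (t.toRingHom.comp γ.hom) (fun a => ht _) (hbase t)
  -- If some tangent vector has r ≠ 0, it generates after rescaling; otherwise the zero vector is
  -- the only one.
  by_cases hex : ∃ t₀ : G.left.presheaf.stalk x →ₐ[K] TrivSqZeroExt K K,
      (∀ a, (t₀ a).fst = ev a) ∧ ∃ r, r ≠ 0 ∧ ∀ a, (t₀ (γ.hom a)).snd = r * c a
  · obtain ⟨t₀, ht₀, r₀, hr₀, h₀⟩ := hex
    refine ⟨t₀, ht₀, fun t ht => ?_⟩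
    obtain ⟨r, hr⟩ := hc' t ht
    refine ⟨r / r₀, hext _ _ fun a => ?_⟩
    ext
    · simp [ht, ht₀]
    · simp [hr, h₀]
      field_simp
  · refine ⟨t₁, ht₁, fun t ht => ⟨0, hext _ _ fun a => ?_⟩⟩
    obtain ⟨r, hr⟩ := hc' t ht
    have hr0 : r = 0 := by
      by_contra h
      exact hex ⟨t, ht, r, h, hr⟩
    ext
    · simp [ht, ht₁]
    · simp [hr, hr0]

/-- The endomorphism ring of an elliptic curve in characteristic zero is commutative. -/
theorem IsEllipticCurve.comp_comm {K : Type u} [Field K] [CharZero K] {C : GrpSch K}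
    (hC : IsEllipticCurve C) (f g : C ⟶ C) : f ≫ g = g ≫ f := by
  obtain ⟨hA, hS⟩ := hC
  have := hA.isProper
  have := IsAbelianVariety.isIntegral C
  have : IsLocallyNoetherian C.X.left := LocallyOfFiniteType.isLocallyNoetherian C.X.hom
  obtain ⟨x, _, ev, j, hj, hjx⟩ := exists_isLocalAtOne C.X
  obtain ⟨t₀, ht₀, h₀⟩ := exists_tangent_generator (ev := ev) hjx
  refine eq_of_isDominant_comp_eq (C.X.left.fromSpecStalk x) _ _ ?_
  rw [← hjx]
  exact congrArg CommaMorphism.left (hj.comp_comm t₀ h₀ ht₀ f g)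

end TangentSpace

end RibetClass

end

open RibetClass in
theorem mainTheorem11 {k Ω : Type u} [Field k] [NumberField k] [Field Ω] [Algebra k Ω]
    [IsAlgClosure k Ω] :
    (∀ B : GrpSch Ω, IsKVariety k B → IsSimpleAbelianVariety B →
      ∀ t : ℕ, HasSchurIndex (End0 B) t →
      ∀ n : ℕ, HasModelUpToIsogeny k (power B n) →
      ∀ μ : CompatibleSystem k B, μ.cohomologyClass ^ (n * t) = 1) ∧
    (∀ C : GrpSch Ω, IsKVariety k C → IsEllipticCurve C →
      ∀ g : ℕ, HasModelUpToIsogeny k (power C g) →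
      ∀ μ : CompatibleSystem k C, μ.cohomologyClass ^ g = 1) := by
  have : Algebra.IsAlgebraic k Ω := IsAlgClosure.isAlgebraic
  have : CharZero Ω := charZero_of_injective_algebraMap (algebraMap k Ω).injective
  exact ⟨fun B _ hB _ ht _ hn μ => μ.cohomologyClass_pow_eq_one_of_isSimple hB ht hn,
    fun C _ hC _ hg μ => μ.cohomologyClass_pow_eq_one_of_comm hC.comp_comm hg⟩
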